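/- Let $\mathfrak X$ be a connected smooth Riemannian manifold (Hausdorff, second countable, without boundary) of dimension $n\ge 1$, with geodesic distance $\mathrm{dist}$ and Riemannian volume measure $\omega$, and let $\mathscr M(\mathfrak X)$ be the set of Borel probability measures on $\mathfrak X$ with the weak topology. Let $\mathrm g:\mathfrak X\times\mathfrak X\to(-\infty,+\infty]$, $V:\mathfrak X\to(-\infty,+\infty]$ and let $\vartheta:\mathfrak X\to[0,\infty)$ be continuous. For $\kappa\ge0$ put $\widetilde V_\kappa=V-\kappa\vartheta$. Assume the following (Assumptions 2). (i) $\mathrm g$ is symmetric and lower semicontinuous, and for every $\epsilon>0$ there is $\delta>0$ such that $|\mathrm g(u,x)|\le\epsilon\,\mathrm{dist}(u,x)^{-n}$ whenever $\mathrm{dist}(u,x)\le\delta$ (the bound being $+\infty$ if $u=x$). (ii) There are $p>1$ and real numbers $\mathrm c_k\ge0$ with $\mathrm c_k\to0$ such that for every integer $k\ge1$ one can write $\mathrm g=\mathrm g_k+\mathrm g^k$, where $\mathrm g_k:\mathfrak X\times\mathfrak X\to\mathbb R$ is continuous, $\mathrm g_k\le k$, $\mathrm g^k:\mathfrak X\times\mathfrak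 X\to[0,+\infty]$, and $\int\mathrm g^k(u,x)^p\,\omega(dx)\le\mathrm c_k$ for all $u\in\mathfrak X$. (iii) $-\mathrm g(u,x)\le\vartheta(u)+\vartheta(x)$ for all $u,x\in\mathfrak X$. (iv) For every $\kappa\ge0$, $\widetilde V_\kappa$ is bounded from below, the set $\{\widetilde V_\kappa<+\infty\}$ is open and non-empty, $\widetilde V_\kappa$ is continuous on it, and $\int e^{-\widetilde V_\kappa}\,d\omega<+\infty$ (with $e^{-\infty}=0$). For $\gamma\ge0$ and $\mu\in\mathscr M(\mathfrak X)$ define the free energy $$\mathscr F_\gamma(\mu)=\frac\gamma2\iint\big(\mathrm g(x,z)+\vartheta(x)+\vartheta(z)\big)\,\mu(dz)\mu(dx)+\mathrm H(\mu\,|\,\nu_\gamma)\in[0,+\infty],$$ where $\nu_\gamma(dx)=\mathrm C_\gamma^{-1}e^{-\widetilde V_\gamma(x)}\omega(dx)$, with $\mathrm C_\gamma=\int e^{-\widetilde V_\gamma}d\omega$, $\mathrm H$ is the relative entropy, and $0\cdot\infty=0$. Fix $\gamma\ge 0$ and suppose that $\mathscr F_\gamma$ has a unique minimizer $\mu_\gamma$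 in $\mathscr M(\mathfrak X)$. Then: (a) (Law of large numbers.) Let $(\beta_N)_{N\ge1}$ be positive numbers with $\beta_N N\to\gamma$ as $N\to\infty$, and for $N\ge1$ let $$\mathbb P_N[d\mathbf x]=\frac1{\mathrm Z_N}\exp\Big(-\beta_N\sum_{1\le i<j\le N}\mathrm g(x_i,x_j)-\sum_{j=1}^NV(x_j)\Big)\prod_{j=1}^N\omega(dx_j)$$ on $\mathfrak X^N$, where $\mathrm Z_N$ is the integral of the exponential with respect to $\omega^{\otimes N}$. Then every $\mathbb P_N$ is a well-defined probability measure, and under $\mathbb P_N$ the empirical measure $\widehat\mu_N=\frac1N\sum_{j=1}^N\delta_{x_j}$ converges in probability to $\mu_\gamma$: for every neighbourhood $\mathcal U$ of $\mu_\gamma$ in $\mathscr M(\mathfrak X)$, $\mathbb P_N[\widehat\mu_N\notin\mathcal U]\to0$ as $N\to\infty$. (b) (Equilibrium measure.) For every $x\in\mathfrak X$ the function $\mathrm g(x,\cdot)$ is $\mu_\gamma$-almost everywhere finite and $\mu_\gamma$-integrable, the potential $\mathscr U^{\mu_\gamma}(x)=\int\mathrm g(x,z)\,\mu_\gamma(dz)$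 is continuous on $\mathfrak X$, and there is a constant $\mathrm L_\gamma\in(0,\infty)$ such that $$\mu_\gamma(dx)=\mathrm L_\gamma^{-1}\,e^{-\gamma\,\mathscr U^{\mu_\gamma}(x)-V(x)}\,\omega(dx).$$ -/

import Mathlib

open MeasureTheory Filter Topology Bundle InformationTheory
open scoped ENNReal NNReal

noncomputable section

namespace GibbsGas

section Volume

variable {n : ℕ} {M : Type*} [MetricSpace M] [ChartedSpace (EuclideanSpace ℝ (Fin n)) M]

/-- The Gram matrix `(g_{ij})` of the Riemannian metric in the local coordinates given by the
chart `e`, at the point of `M` with coordinates `y`: the entries are the inner products of the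
coordinate vector fields `∂_i`, `∂_j` at `e.symm y`. -/
def gramMatrix [RiemannianBundle
      (fun x : M => TangentSpace (modelWithCornersSelf ℝ (EuclideanSpace ℝ (Fin n))) x)]
    (e : OpenPartialHomeomorph M (EuclideanSpace ℝ (Fin n))) (y : EuclideanSpace ℝ (Fin n)) :
    Matrix (Fin n) (Fin n) ℝ :=
  let D := mfderiv (modelWithCornersSelf ℝ (EuclideanSpace ℝ (Fin n)))
    (modelWithCornersSelf ℝ (EuclideanSpace ℝ (Fin n))) e.symm y
  Matrix.of fun i j =>
    inner ℝ (D (EuclideanSpace.single i (1 : ℝ))) (D (EuclideanSpace.single j (1 : ℝ)))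

/-- The Riemannian volume on the domain of the chart `e`, that is, `√(det g) dx₁ ⋯ dxₙ` in the
coordinates of `e`. -/
def chartVolume [MeasurableSpace M] [RiemannianBundle
      (fun x : M => TangentSpace (modelWithCornersSelf ℝ (EuclideanSpace ℝ (Fin n))) x)]
    (e : OpenPartialHomeomorph M (EuclideanSpace ℝ (Fin n))) : Measure M :=
  ((volume.restrict e.target).withDensity
    fun y => ENNReal.ofReal (Real.sqrt (gramMatrix e y).det)).map e.symm

variable (n M) in
theorem exists_countable_chart_cover [Nonempty M] [SecondCountableTopology M] :
    ∃ c : ℕ → M, (⋃ i, (chartAt (EuclideanSpace ℝ (Fin n)) (c i)).source) = Set.univ := by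
  obtain ⟨s, hs, hcov⟩ := TopologicalSpace.countable_cover_nhds
    (fun x : M => chart_source_mem_nhds (EuclideanSpace ℝ (Fin n)) x)
  have hne : s.Nonempty := by
    rw [Set.nonempty_iff_ne_empty]
    rintro rfl
    exact Set.empty_ne_univ (by simpa using hcov)
  obtain ⟨c, rfl⟩ := hs.exists_eq_range hne
  exact ⟨c, by simpa [Set.biUnion_range] using hcov⟩

variable (n M) in
/-- The centres of a countable family of charts covering `M`. -/
def chartCenter [Nonempty M] [SecondCountableTopology M] : ℕ → M :=
  (exists_countable_chart_cover n M).choose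

variable (n M) in
/-- The Riemannian volume measure of `M`: the chart volumes of a countable family of charts
covering `M`, glued along the partition of `M` obtained by making the chart domains disjoint.
As the chart volumes agree on overlaps, the outcome is the usual volume, whichever the family. -/
def riemannianVolume [Nonempty M] [SecondCountableTopology M] [MeasurableSpace M]
    [RiemannianBundle
      (fun x : M => TangentSpace (modelWithCornersSelf ℝ (EuclideanSpace ℝ (Fin n))) x)] :
    Measure M :=
  Measure.sum fun i =>
    (chartVolume (chartAt (EuclideanSpace ℝ (Fin n)) (chartCenter n M i))).restrict
      (disjointed
        (fun j => (chartAt (EuclideanSpace ℝ (Fin n)) (chartCenter n M j)).source) i)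

end Volume

section Assumptions

variable {M : Type*}

/-- The modified potential `V - κ ϑ`. -/
def shiftedPotential (V : M → EReal) (θ : M → ℝ) (κ : ℝ) (x : M) : EReal :=
  V x - ((κ * θ x : ℝ) : EReal)

variable [MetricSpace M] [MeasurableSpace M]

/-- The condition on a confining potential `W`: it is bounded from below, the set `{W < +∞}` is
open and non-empty, `W` is continuous on it, and `e^{-W}` is integrable
(`EReal.exp ⊥ = 0`, so `e^{-W} = 0` where `W = +∞`). -/
structure IsConfining (ω : Measure M) (W : M → EReal) : Prop where
  bddBelow : ∃ c : ℝ, ∀ x, (c : EReal) ≤ W x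
  isOpen : IsOpen {x | W x < ⊤}
  nonempty : {x | W x < ⊤}.Nonempty
  continuousOn : ContinuousOn W {x | W x < ⊤}
  integrable : ∫⁻ x, EReal.exp (-W x) ∂ω < ⊤

/-- The assumptions on the kernel `g`, the potential `V` and the function `ϑ`, on a space of
dimension `n` with volume measure `ω`. -/
structure Assumptions (n : ℕ) (ω : Measure M) (g : M → M → EReal) (V : M → EReal)
    (θ : M → ℝ) : Prop where
  kernel_ne_bot : ∀ u x, g u x ≠ ⊥
  potential_ne_bot : ∀ x, V x ≠ ⊥
  symm : ∀ u x, g u x = g x u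
  lsc : LowerSemicontinuous fun q : M × M => g q.1 q.2
  /-- `|g(u, x)| ≤ ε dist(u, x)^{-n}` near the diagonal; the bound is `+∞` on the diagonal. -/
  singularity : ∀ ε : ℝ, 0 < ε → ∃ δ : ℝ, 0 < δ ∧ ∀ u x, dist u x ≤ δ →
    (g u x).abs ≤ ENNReal.ofReal ε / edist u x ^ n
  /-- `g = gc k + gs k` with `gc k ≤ k` continuous and `gs k ≥ 0` small in `L^p`, uniformly. -/
  decomposition : ∃ (gc : ℕ → M → M → ℝ) (gs : ℕ → M → M → ℝ≥0∞) (p : ℝ) (c : ℕ → ℝ≥0),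
    1 < p ∧ Tendsto c atTop (𝓝 0) ∧
    ∀ k : ℕ, 1 ≤ k →
      (∀ u x, g u x = (gc k u x : EReal) + (gs k u x : EReal)) ∧
      (∀ u x, gc k u x ≤ k) ∧
      Continuous (fun q : M × M => gc k q.1 q.2) ∧
      ∀ u, ∫⁻ x, gs k u x ^ p ∂ω ≤ c k
  theta_continuous : Continuous θ
  theta_nonneg : ∀ x, 0 ≤ θ x
  neg_kernel_le : ∀ u x, -g u x ≤ ((θ u + θ x : ℝ) : EReal)
  confining : ∀ κ : ℝ, 0 ≤ κ → IsConfining ω (shiftedPotential V θ κ)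

end Assumptions

section Gibbs

variable {M : Type*} [MeasurableSpace M]

/-- The energy `β ∑_{i<j} g(x_i, x_j) + ∑_j V(x_j)` of a configuration. -/
def energy {N : ℕ} (β : ℝ) (g : M → M → EReal) (V : M → EReal) (x : Fin N → M) : EReal :=
  (β : EReal) * (∑ i, ∑ j ∈ Finset.Ioi i, g (x i) (x j)) + ∑ j, V (x j)

/-- The partition function `Z_N`. -/
def partitionFunction (N : ℕ) (ω : Measure M) (β : ℝ) (g : M → M → EReal) (V : M → EReal) :
    ℝ≥0∞ :=
  ∫⁻ x : Fin N → M, EReal.exp (-energy β g V x) ∂(Measure.pi fun _ => ω)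

/-- The Gibbs measure `P_N` on configurations of `N` particles. -/
def gibbsMeasure (N : ℕ) (ω : Measure M) (β : ℝ) (g : M → M → EReal) (V : M → EReal) :
    Measure (Fin N → M) :=
  (partitionFunction N ω β g V)⁻¹ •
    (Measure.pi fun _ => ω).withDensity fun x => EReal.exp (-energy β g V x)

/-- The empirical measure `N⁻¹ ∑_j δ_{x_j}` of a configuration of `N ≥ 1` points. -/
def empiricalMeasure {N : ℕ} [NeZero N] (x : Fin N → M) : ProbabilityMeasure M :=
  ⟨(N : ℝ≥0∞)⁻¹ • ∑ j, Measure.dirac (x j), ⟨by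
    simp [ENNReal.inv_mul_cancel (Nat.cast_ne_zero.2 (NeZero.ne N)) (ENNReal.natCast_ne_top N)]⟩⟩

/-- The weighted energy `∬ (g(x, z) + ϑ(x) + ϑ(z)) μ(dz) μ(dx)`, whose integrand is non-negative
when `-g(x, z) ≤ ϑ(x) + ϑ(z)`. -/
def weightedEnergy (g : M → M → EReal) (θ : M → ℝ) (μ : Measure M) : ℝ≥0∞ :=
  ∫⁻ x, ∫⁻ z, (g x z + ((θ x + θ z : ℝ) : EReal)).toENNReal ∂μ ∂μ

/-- The reference measure `ν_γ = C_γ⁻¹ e^{-(V - γ ϑ)} ω`, `C_γ` being the normalization. -/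
def referenceMeasure (ω : Measure M) (V : M → EReal) (θ : M → ℝ) (γ : ℝ) : Measure M :=
  (∫⁻ x, EReal.exp (-shiftedPotential V θ γ x) ∂ω)⁻¹ •
    ω.withDensity fun x => EReal.exp (-shiftedPotential V θ γ x)

/-- The free energy `F_γ(μ) = (γ / 2) Ẽ(μ) + H(μ | ν_γ)`. -/
def freeEnergy (ω : Measure M) (g : M → M → EReal) (V : M → EReal) (θ : M → ℝ) (γ : ℝ)
    (μ : ProbabilityMeasure M) : ℝ≥0∞ :=
  ENNReal.ofReal (γ / 2) * weightedEnergy g θ (μ : Measure M) +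
    klDiv (μ : Measure M) (referenceMeasure ω V θ γ)

/-- The potential `U^μ(x) = ∫ g(x, z) μ(dz)` generated by `μ`; it is meaningful when `g(x, ·)` is
almost everywhere finite and integrable with respect to `μ`. -/
def potential (g : M → M → EReal) (μ : Measure M) (x : M) : ℝ :=
  ∫ z, (g x z).toReal ∂μ

end Gibbs

end GibbsGas

end

open MeasureTheory Filter Topology Bundle InformationTheory
open scoped ENNReal NNReal

noncomputable section

/-! Write `G(x,z) = g(x,z) + θ(x) + θ(z)`, which is lower semicontinuous and non-negative, so that
the free energy is `γ/2 ∬ G dμdμ + H(μ|ν)` with `ν = ν_γ`.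

Equilibrium measure. The measure `ν` has bounded density and finite energy, so a minimizer `μ` has
finite free energy and integrates `θ`. Put `P = ∫ G(·,z) μ(dz)` and let `σ` be `ν` tilted by `-γP`.
Along `(1-t)μ + tσ` the energy is quadratic and the entropy convex; the first-order condition at `t
= 0` reads exactly `H(μ|σ) ≤ 0`, so `μ = σ` (`minimizer_eq_tilted`). Hence `μ` has bounded density,
Hölder makes the singular part of `g` uniformly small, and two uses of Fatou give continuity of the
potential `U` (`continuous_potential`). Replacing `P` by `U + θ + ∫ θ dμ` turns the fixed-point
equation into the stated density and evaluates the minimum as `log C - log L - γ/2 ∫ U dμ`.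

Law of large numbers. Jensen under the product of copies of `μ` bounds the partition function from
below at exactly the rate of that minimum (`le_partitionFunction`). If `ρ` has larger free energy,
duality yields bounded continuous `K ≤ G` and `h` witnessing this (`exists_test`). Near `ρ` the
Boltzmann factor is then dominated by an exponential times a product of one-particle weights, and
the probability decays exponentially (`exists_nhds_tendsto_gibbsMeasure`). Exponential tightness
reduces the complement of a neighbourhood of `μ` to a compact set, covered by finitely many such
neighbourhoods; uniqueness ensures that every point there is non-minimal. -/

namespace GibbsGas

/-! ### Relative entropy: duality, convexity, integrability. -/

section Entropy

variable {X : Type*} [MeasurableSpace X]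

/-- The integrand `klFun r` is the supremum over `t` of `r t - (exp t - 1)`, attained at `t = log
r`. The test functions are therefore logarithms of the density truncated to `[1/(n+1), n+1]`; the
resulting integrands `ψ n` are non-negative and converge to `klFun φ`, and Fatou concludes. -/
theorem lintegral_ofReal_klFun_le {ν l : Measure X} [IsFiniteMeasure ν] [IsFiniteMeasure l]
    (hac : l ≪ ν) {a : ℝ}
    (h : ∀ f : X → ℝ, Measurable f → (∃ B, ∀ x, |f x| ≤ B) →
      ∫ x, f x ∂l - ∫ x, (Real.exp (f x) - 1) ∂ν ≤ a) :
    klDiv l ν ≤ ENNReal.ofReal a := by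
  rw [klDiv_eq_lintegral_klFun_of_ac hac]
  set φ : X → ℝ := fun x => (l.rnDeriv ν x).toReal with hφ
  have hφm : Measurable φ := (Measure.measurable_rnDeriv l ν).ennreal_toReal
  have hφ0 : ∀ x, 0 ≤ φ x := fun x => ENNReal.toReal_nonneg
  have hφi : Integrable φ ν := Measure.integrable_toReal_rnDeriv
  set c : ℕ → X → ℝ := fun n x => max ((n + 1 : ℝ)⁻¹) (min (φ x) (n + 1)) with hc
  have hpos : ∀ n : ℕ, (0 : ℝ) < (n + 1 : ℝ)⁻¹ := fun n => by positivity
  have hle1 : ∀ n : ℕ, (n + 1 : ℝ)⁻¹ ≤ 1 := fun n => inv_le_one_of_one_le₀ (by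
    have : (0 : ℝ) ≤ n := n.cast_nonneg
    linarith)
  have hc_low : ∀ (n : ℕ) x, (n + 1 : ℝ)⁻¹ ≤ c n x := fun n x => le_max_left _ _
  have hc_pos : ∀ n x, 0 < c n x := fun n x => (hpos n).trans_le (hc_low n x)
  have hc_up : ∀ (n : ℕ) x, c n x ≤ n + 1 := fun n x => max_le ((hle1 n).trans (by
    have : (0 : ℝ) ≤ n := n.cast_nonneg
    linarith)) (min_le_right _ _)
  have hcm : ∀ n, Measurable (c n) := fun n => measurable_const.max (hφm.min measurable_const)
  have hlogB : ∀ (n : ℕ) x, |Real.log (c n x)| ≤ Real.log (n + 1) := by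
    intro n x
    rw [abs_le]
    constructor
    · rw [← Real.log_inv]
      exact Real.log_le_log (hpos n) (hc_low n x)
    · exact Real.log_le_log (hc_pos n x) (hc_up n x)
  set ψ : ℕ → X → ℝ := fun n x => φ x * Real.log (c n x) - (c n x - 1) with hψ
  have hψ0 : ∀ n x, 0 ≤ ψ n x := by
    intro n x
    have h1 : c n x - 1 ≤ c n x * Real.log (c n x) := by
      have := Real.one_sub_inv_le_log_of_pos (hc_pos n x)
      have h2 := mul_le_mul_of_nonneg_left this (hc_pos n x).le
      rwa [mul_sub, mul_inv_cancel₀ (hc_pos n x).ne', mul_one] at h2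
    -- Truncation moves `φ` towards `1`: it increases `φ` only to a value at most `1`, and decreases
    -- it only to a value at least `1`. So `φ - c` and `log c` never have opposite signs.
    have h2 : c n x * Real.log (c n x) ≤ φ x * Real.log (c n x) := by
      rcases le_total (φ x) (c n x) with h3 | h3
      · rcases h3.eq_or_lt with h4 | h4
        · rw [h4]
        · have h5 : c n x ≤ 1 := by
            by_contra h6
            have h7 : c n x = min (φ x) (n + 1) := by
              rcases max_choice ((n + 1 : ℝ)⁻¹) (min (φ x) (n + 1)) with h8 | h8
              · exact absurd (h8.le.trans (hle1 n)) h6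
              · exact h8
            exact absurd (h7.le.trans (min_le_left _ _)) (not_le.2 h4)
          exact mul_le_mul_of_nonpos_right h3 (Real.log_nonpos (hc_pos n x).le h5)
      · rcases h3.eq_or_lt with h4 | h4
        · rw [h4]
        · have h5 : 1 ≤ c n x := by
            have h6 : min (φ x) (n + 1) < φ x := (le_max_right _ _).trans_lt h4
            have h7 : (n + 1 : ℝ) ≤ φ x := by
              by_contra h8
              rw [min_eq_left (not_le.1 h8).le] at h6
              exact lt_irrefl _ h6
            calc (1 : ℝ) ≤ n + 1 := by
                  have : (0 : ℝ) ≤ n := n.cast_nonneg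
                  linarith
              _ = min (φ x) (n + 1) := (min_eq_right h7).symm
              _ ≤ c n x := le_max_right _ _
          exact mul_le_mul_of_nonneg_right h3 (Real.log_nonneg h5)
    simp only [hψ]
    linarith
  have hψlim : ∀ x, Tendsto (fun n => ψ n x) atTop (𝓝 (klFun (φ x))) := by
    intro x
    have hcl : Tendsto (fun n => c n x) atTop (𝓝 (φ x)) := by
      have h1 : Tendsto (fun n : ℕ => (n + 1 : ℝ)⁻¹) atTop (𝓝 0) := by
        simpa [one_div] using tendsto_one_div_add_atTop_nhds_zero_nat (𝕜 := ℝ)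
      have h2 : Tendsto (fun n : ℕ => min (φ x) (n + 1 : ℝ)) atTop (𝓝 (φ x)) := by
        apply tendsto_const_nhds.congr'
        filter_upwards [(tendsto_natCast_atTop_atTop (R := ℝ)).eventually_ge_atTop (φ x)] with n hn
        rw [min_eq_left]
        linarith
      simpa [max_eq_right (hφ0 x)] using h1.max h2
    rcases (hφ0 x).eq_or_lt with h0 | h0
    · rw [← h0] at hcl ⊢
      simp only [hψ, ← h0, zero_mul, klFun_zero]
      simpa using (tendsto_const_nhds (x := (0 : ℝ))).sub (hcl.sub_const 1)
    · have h1 := (hcl.log h0.ne').const_mul (φ x)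
      have h2 := h1.sub (hcl.sub_const 1)
      rw [klFun_apply]
      convert h2 using 2
      ring
  have hψi : ∀ n, Integrable (ψ n) ν := by
    intro n
    refine Integrable.sub ?_ (Integrable.sub ?_ (integrable_const _))
    · exact hφi.mul_bdd (c := Real.log (n + 1)) (hcm n).log.aestronglyMeasurable
        (ae_of_all _ fun x => hlogB n x)
    · refine Integrable.of_bound (hcm n).aestronglyMeasurable (n + 1) (ae_of_all _ fun x => ?_)
      rw [Real.norm_eq_abs, abs_of_pos (hc_pos n x)]
      exact hc_up n x
  have hint : ∀ n, ∫ x, ψ n x ∂ν ≤ a := by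
    intro n
    have h1 := h (fun x => Real.log (c n x)) (hcm n).log ⟨_, hlogB n⟩
    have h2 : ∫ x, φ x * Real.log (c n x) ∂ν = ∫ x, Real.log (c n x) ∂l := by
      rw [← integral_rnDeriv_smul hac]
      rfl
    simp only [Real.exp_log (hc_pos n _)] at h1
    rw [← h2, ← integral_sub] at h1
    · exact h1
    · exact hφi.mul_bdd (c := Real.log (n + 1)) (hcm n).log.aestronglyMeasurable
        (ae_of_all _ fun x => hlogB n x)
    · refine Integrable.sub ?_ (integrable_const _)
      refine Integrable.of_bound (hcm n).aestronglyMeasurable (n + 1) (ae_of_all _ fun x => ?_)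
      rw [Real.norm_eq_abs, abs_of_pos (hc_pos n x)]
      exact hc_up n x
  calc ∫⁻ x, ENNReal.ofReal (klFun (φ x)) ∂ν
      = ∫⁻ x, liminf (fun n => ENNReal.ofReal (ψ n x)) atTop ∂ν := by
        refine lintegral_congr fun x => ?_
        exact ((ENNReal.tendsto_ofReal (hψlim x)).liminf_eq).symm
    _ ≤ liminf (fun n => ∫⁻ x, ENNReal.ofReal (ψ n x) ∂ν) atTop := by
        refine lintegral_liminf_le' fun n => ?_
        exact ((hφm.mul (hcm n).log).sub ((hcm n).sub_const 1)).ennreal_ofReal.aemeasurable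
    _ ≤ ENNReal.ofReal a := by
        refine liminf_le_of_frequently_le' (Frequently.of_forall fun n => ?_)
        rw [← ofReal_integral_eq_lintegral_ofReal (hψi n) (ae_of_all _ (hψ0 n))]
        exact ENNReal.ofReal_le_ofReal (hint n)

/-- The relative entropy is bounded by the supremum of its Legendre transform over bounded
continuous functions. -/
theorem klDiv_le_of_forall_boundedContinuous {X : Type*} [MeasurableSpace X] [MetricSpace X]
    [BorelSpace X] {ν l : Measure X} [IsFiniteMeasure ν] [IsFiniteMeasure l] {a : ℝ}
    (h : ∀ f : BoundedContinuousFunction X ℝ,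
      ∫ x, f x ∂l - ∫ x, (Real.exp (f x) - 1) ∂ν ≤ a) :
    klDiv l ν ≤ ENNReal.ofReal a := by
  have key : ∀ f : X → ℝ, Measurable f → (∃ B, ∀ x, |f x| ≤ B) →
      ∫ x, f x ∂l - ∫ x, (Real.exp (f x) - 1) ∂ν ≤ a := by
    rintro f hf ⟨B, hB⟩
    have hB' : ∀ x, -B ≤ f x ∧ f x ≤ B := fun x => abs_le.1 (hB x)
    have hint : ∀ (ρ : Measure X) [IsFiniteMeasure ρ], Integrable f ρ := fun ρ _ =>
      Integrable.of_bound hf.aestronglyMeasurable B (ae_of_all _ hB)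
    refine le_of_forall_pos_le_add fun ε hε => ?_
    -- Approximation in `L¹(l + ν)` controls both integrals at once. After clipping to `[-B, B]` the
    -- exponential is Lipschitz with constant `exp B`, hence the factor `1 + exp B`.
    obtain ⟨u, hu, -⟩ := (hint (l + ν)).exists_boundedContinuous_integral_sub_le
      (ε := ε / (1 + Real.exp B)) (by positivity)
    rcases isEmpty_or_nonempty X with hX | ⟨⟨x₀⟩⟩
    · have := h 0
      simp [integral_of_isEmpty] at this ⊢
      linarith
    have hB0 : -B ≤ B := (hB' x₀).1.trans (hB' x₀).2
    have htr : ∀ x, |max (-B) (min (u x) B)| ≤ B := fun x =>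
      abs_le.2 ⟨le_max_left _ _, max_le hB0 (min_le_right _ _)⟩
    let v : BoundedContinuousFunction X ℝ := BoundedContinuousFunction.ofNormedAddCommGroup
      (fun x => max (-B) (min (u x) B)) (by fun_prop) B htr
    have hv : ∀ x, v x = max (-B) (min (u x) B) := fun x => rfl
    have hvB : ∀ x, |v x| ≤ B := htr
    have hfv : ∀ x, |f x - v x| ≤ |f x - u x| := by
      intro x
      have h1 : f x = max (-B) (min (f x) B) := by
        rw [min_eq_left (hB' x).2, max_eq_right (hB' x).1]
      rw [h1, hv]
      refine (abs_max_sub_max_le_max _ _ _ _).trans ?_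
      rw [sub_self, abs_zero, max_eq_right (abs_nonneg _)]
      refine (abs_min_sub_min_le_max _ _ _ _).trans ?_
      rw [sub_self, abs_zero, max_eq_left (abs_nonneg _), ← h1]
    have hvi : ∀ (ρ : Measure X) [IsFiniteMeasure ρ], Integrable v ρ := fun ρ _ => v.integrable ρ
    have hexpi : ∀ w : X → ℝ, Measurable w → (∀ x, |w x| ≤ B) →
        Integrable (fun x => Real.exp (w x) - 1) ν := by
      intro w hw hwB
      refine (Integrable.of_bound hw.exp.aestronglyMeasurable (Real.exp B)
        (ae_of_all _ fun x => ?_)).sub (integrable_const _)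
      rw [Real.norm_eq_abs, abs_of_pos (Real.exp_pos _)]
      exact Real.exp_le_exp.2 (le_of_abs_le (hwB x))
    have hui : ∀ (ρ : Measure X) [IsFiniteMeasure ρ], Integrable (fun x => |f x - u x|) ρ :=
      fun ρ _ => ((hint ρ).sub (u.integrable ρ)).abs
    have h1 : ∫ x, f x ∂l ≤ ∫ x, v x ∂l + ∫ x, |f x - u x| ∂l := by
      rw [← integral_add (hvi l) (hui l)]
      refine integral_mono (hint l) ((hvi l).add (hui l)) fun x => ?_
      have := (le_abs_self _).trans (hfv x)
      simp only
      linarith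
    have h2 : ∫ x, (Real.exp (v x) - 1) ∂ν ≤
        ∫ x, (Real.exp (f x) - 1) ∂ν + Real.exp B * ∫ x, |f x - u x| ∂ν := by
      rw [← integral_const_mul, ← integral_add (hexpi f hf hB) ((hui ν).const_mul _)]
      refine integral_mono (hexpi v v.continuous.measurable hvB)
        ((hexpi f hf hB).add ((hui ν).const_mul _)) fun x => ?_
      have h3 : Real.exp (v x) - Real.exp (f x) ≤ Real.exp B * |f x - u x| := by
        have h4 : Real.exp (v x) * (v x - f x + 0) ≥ Real.exp (v x) - Real.exp (f x) := by
          have h5 := Real.add_one_le_exp (f x - v x)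
          have h6 := mul_le_mul_of_nonneg_left h5 (Real.exp_pos (v x)).le
          rw [← Real.exp_add] at h6
          have h7 : v x + (f x - v x) = f x := by ring
          rw [h7] at h6
          linarith
        refine h4.le.trans ?_
        rw [add_zero]
        have h8 : v x - f x ≤ |f x - u x| := by
          rw [← neg_sub]
          exact (neg_le_abs _).trans (hfv x)
        calc Real.exp (v x) * (v x - f x) ≤ Real.exp (v x) * |f x - u x| :=
              mul_le_mul_of_nonneg_left h8 (Real.exp_pos _).le
          _ ≤ Real.exp B * |f x - u x| :=
              mul_le_mul_of_nonneg_right (Real.exp_le_exp.2 (le_of_abs_le (hvB x))) (abs_nonneg _)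
      simp only
      linarith
    have h3 : ∫ x, |f x - u x| ∂l + ∫ x, |f x - u x| ∂ν ≤ ε / (1 + Real.exp B) := by
      rw [← integral_add_measure (hui l) (hui ν)]
      exact hu
    have h4 := h v
    have h5 : 0 ≤ ∫ x, |f x - u x| ∂l := integral_nonneg fun x => abs_nonneg _
    have h6 : 0 ≤ ∫ x, |f x - u x| ∂ν := integral_nonneg fun x => abs_nonneg _
    have h7 : (1 + Real.exp B) * (∫ x, |f x - u x| ∂l + ∫ x, |f x - u x| ∂ν) ≤ ε := by
      have := Real.exp_pos B
      rw [le_div_iff₀ (by positivity)] at h3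
      linarith
    nlinarith [mul_nonneg (Real.exp_pos B).le h5]
  refine lintegral_ofReal_klFun_le ?_ key
  -- On a `ν`-null set `s`, testing with `t` times its indicator gives `t * l(s) ≤ a` for every `t`,
  -- which forces `l(s) = 0`.
  refine Measure.AbsolutelyContinuous.mk fun s hs hνs => ?_
  have h1 : ∀ t : ℝ, t * l.real s ≤ a := by
    intro t
    have h2 := key (s.indicator fun _ => t) (measurable_const.indicator hs) ⟨|t|, fun x => by
      by_cases hx : x ∈ s <;> simp [hx]⟩
    have h3 : ∫ x, (Real.exp (s.indicator (fun _ => t) x) - 1) ∂ν = 0 := by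
      refine integral_eq_zero_of_ae ?_
      have : ∀ᵐ x ∂ν, x ∉ s := measure_eq_zero_iff_ae_notMem.1 hνs
      filter_upwards [this] with x hx
      simp [hx]
    rw [h3, integral_indicator_const _ hs] at h2
    simpa [mul_comm] using h2
  by_contra h0
  have h2 : 0 < l.real s := ENNReal.toReal_pos h0 (measure_ne_top _ _)
  have h3 := h1 ((a + 1) / l.real s)
  rw [div_mul_cancel₀ _ h2.ne'] at h3
  linarith

/-- The relative entropy is convex in its first argument. -/
theorem klDiv_add_smul_le {ν μ σ : Measure X} [IsFiniteMeasure ν] [IsFiniteMeasure μ]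
    [IsFiniteMeasure σ] (hμ : μ ≪ ν) (hσ : σ ≪ ν) {s t : ℝ≥0} (hst : s + t = 1) :
    klDiv (s • μ + t • σ) ν ≤ s * klDiv μ ν + t * klDiv σ ν := by
  have hac : s • μ + t • σ ≪ ν := by
    refine Measure.AbsolutelyContinuous.add_left_iff.2 ⟨?_, ?_⟩
    · exact hμ.smul_left s
    · exact hσ.smul_left t
  rw [klDiv_eq_lintegral_klFun_of_ac hac, klDiv_eq_lintegral_klFun_of_ac hμ,
    klDiv_eq_lintegral_klFun_of_ac hσ, ← lintegral_const_mul' _ _ ENNReal.coe_ne_top,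
    ← lintegral_const_mul' _ _ ENNReal.coe_ne_top, ← lintegral_add_left (by fun_prop)]
  refine lintegral_mono_ae ?_
  filter_upwards [Measure.rnDeriv_add (s • μ) (t • σ) ν, Measure.rnDeriv_smul_left μ ν s,
    Measure.rnDeriv_smul_left σ ν t, Measure.rnDeriv_lt_top μ ν, Measure.rnDeriv_lt_top σ ν]
    with x h1 h2 h3 h4 h5
  rw [h1]
  simp only [Pi.add_apply, h2, h3, Pi.smul_apply]
  rw [ENNReal.toReal_add (by simpa [ENNReal.smul_def] using ENNReal.mul_ne_top ENNReal.coe_ne_top h4.ne)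
    (by simpa [ENNReal.smul_def] using ENNReal.mul_ne_top ENNReal.coe_ne_top h5.ne)]
  simp only [ENNReal.smul_def, smul_eq_mul, ENNReal.toReal_mul, ENNReal.coe_toReal]
  have h6 := convexOn_klFun.2 (x := (μ.rnDeriv ν x).toReal) ENNReal.toReal_nonneg
    (y := (σ.rnDeriv ν x).toReal) ENNReal.toReal_nonneg s.coe_nonneg t.coe_nonneg (by rw [← NNReal.coe_add, hst, NNReal.coe_one])
  simp only [smul_eq_mul] at h6
  refine (ENNReal.ofReal_le_ofReal h6).trans ?_
  rw [ENNReal.ofReal_add (mul_nonneg s.coe_nonneg (klFun_nonneg ENNReal.toReal_nonneg))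
    (mul_nonneg t.coe_nonneg (klFun_nonneg ENNReal.toReal_nonneg)), ENNReal.ofReal_mul s.coe_nonneg,
    ENNReal.ofReal_mul t.coe_nonneg]
  simp

/-- A function with finite exponential moment is integrable for measures of finite entropy. -/
theorem integrable_of_klDiv_ne_top {ν l : Measure X} [IsFiniteMeasure ν] [IsFiniteMeasure l]
    (hkl : klDiv l ν ≠ ∞) {f : X → ℝ} (hf : Measurable f) (hf0 : ∀ x, 0 ≤ f x)
    (hexp : ∫⁻ x, ENNReal.ofReal (Real.exp (f x)) ∂ν < ∞) : Integrable f l := by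
  have hac : l ≪ ν := (klDiv_ne_top_iff.1 hkl).1
  refine ⟨hf.aestronglyMeasurable, ?_⟩
  rw [hasFiniteIntegral_iff_ofReal (ae_of_all _ hf0), ← lintegral_rnDeriv_mul hac
    hf.ennreal_ofReal.aemeasurable]
  rw [klDiv_eq_lintegral_klFun_of_ac hac] at hkl
  -- Young's inequality `r t ≤ klFun r + exp t`, with `r` the density and `t = f x`.
  refine lt_of_le_of_lt ?_ (ENNReal.add_lt_top.2 ⟨hkl.lt_top, hexp⟩)
  rw [← lintegral_add_left (by fun_prop)]
  refine lintegral_mono_ae ?_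
  filter_upwards [Measure.rnDeriv_lt_top l ν] with x hx
  have h0 : 0 ≤ (l.rnDeriv ν x).toReal := ENNReal.toReal_nonneg
  have h1 : l.rnDeriv ν x = ENNReal.ofReal (l.rnDeriv ν x).toReal := (ENNReal.ofReal_toReal hx.ne).symm
  rw [← ENNReal.ofReal_add (klFun_nonneg h0) (Real.exp_pos _).le]
  conv_lhs => rw [h1]
  rw [← ENNReal.ofReal_mul h0]
  refine ENNReal.ofReal_le_ofReal ?_
  generalize (l.rnDeriv ν x).toReal = r at h0
  rw [klFun_apply]
  rcases h0.eq_or_lt with h2 | h2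
  · rw [← h2]
    have := Real.exp_pos (f x)
    simp
    linarith
  · have h3 := Real.add_one_le_exp (f x - Real.log r)
    rw [Real.exp_sub, Real.exp_log h2, le_div_iff₀ h2] at h3
    nlinarith

end Entropy

/-! ### Lower semicontinuous functions and Fatou's lemma. -/

section Semicontinuity

/-- **Fatou's lemma** for lower semicontinuity of integrals with a parameter. -/
theorem lowerSemicontinuous_lintegral {X Y : Type*} [TopologicalSpace X] [FirstCountableTopology X]
    [MeasurableSpace Y] {μ : Measure Y} {f : X → Y → ℝ≥0∞} (hm : ∀ x, Measurable (f x))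
    (hf : ∀ y, LowerSemicontinuous fun x => f x y) :
    LowerSemicontinuous fun x => ∫⁻ y, f x y ∂μ := by
  refine lowerSemicontinuous_iff_le_liminf.2 fun x => ?_
  calc ∫⁻ y, f x y ∂μ ≤ ∫⁻ y, liminf (fun x' => f x' y) (𝓝 x) ∂μ :=
        lintegral_mono fun y => lowerSemicontinuous_iff_le_liminf.1 (hf y) x
    _ ≤ _ := lintegral_liminf_le' fun x' => (hm x').aemeasurable

/-- A lower semicontinuous function with values in `[0, ∞]` on a metric space is a limit of bounded
continuous functions which it dominates. -/
theorem exists_boundedContinuous_le_liminf {X : Type*} [PseudoMetricSpace X] {G : X → ℝ≥0∞}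
    (hG : LowerSemicontinuous G) :
    ∃ K : ℕ → BoundedContinuousFunction X ℝ, (∀ n q, 0 ≤ K n q) ∧
      (∀ n q, ENNReal.ofReal (K n q) ≤ G q) ∧
      ∀ q, G q ≤ liminf (fun n => ENNReal.ofReal (K n q)) atTop := by
  set T : ℕ → X → ℝ := fun n q => (min (G q) n).toReal with hT
  have hT0 : ∀ n q, 0 ≤ T n q := fun n q => ENNReal.toReal_nonneg
  have hTn : ∀ n q, T n q ≤ n := fun n q => by
    have := ENNReal.toReal_mono (ENNReal.natCast_ne_top n) (min_le_right (G q) n)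
    simpa using this
  have hTG : ∀ n q, ENNReal.ofReal (T n q) ≤ G q := fun n q => by
    rw [hT, ENNReal.ofReal_toReal (ne_top_of_le_ne_top (ENNReal.natCast_ne_top n)
      (min_le_right _ _))]
    exact min_le_left _ _
  -- Inf-convolution of the truncation `min G n` with `n * dist`: it is `n`-Lipschitz and lies
  -- between `0` and the truncation.
  set k : ℕ → X → ℝ := fun n q => ⨅ z, (T n z + n * dist q z) with hk
  have hbdd : ∀ n q, BddBelow (Set.range fun z => T n z + n * dist q z) := fun n q =>
    ⟨0, by rintro _ ⟨z, rfl⟩; exact add_nonneg (hT0 n z) (by positivity)⟩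
  have hk0 : ∀ n q, 0 ≤ k n q := fun n q =>
    Real.iInf_nonneg fun z => add_nonneg (hT0 n z) (by positivity)
  have hkT : ∀ n q, k n q ≤ T n q := fun n q => by
    refine (ciInf_le (hbdd n q) q).trans ?_
    simp
  have hlip : ∀ n : ℕ, LipschitzWith (n : ℝ≥0) (k n) := by
    intro n
    refine LipschitzWith.of_le_add_mul _ fun q q' => ?_
    have : Nonempty X := ⟨q⟩
    rw [← sub_le_iff_le_add]
    refine le_ciInf fun z => ?_
    rw [sub_le_iff_le_add]
    refine (ciInf_le (hbdd n q) z).trans ?_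
    have h1 := dist_triangle q q' z
    have h2 : (0 : ℝ) ≤ n := n.cast_nonneg
    have h3 := mul_le_mul_of_nonneg_left h1 h2
    simp only [NNReal.coe_natCast]
    linarith
  refine ⟨fun n => BoundedContinuousFunction.ofNormedAddCommGroup (k n) (hlip n).continuous n
    fun q => ?_, fun n q => hk0 n q, fun n q => ?_, fun q => ?_⟩
  · rw [Real.norm_eq_abs, abs_of_nonneg (hk0 n q)]
    exact (hkT n q).trans (hTn n q)
  · exact (ENNReal.ofReal_le_ofReal (hkT n q)).trans (hTG n q)
  · refine le_of_forall_lt_imp_le_of_dense fun a ha => ?_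
    have hatop : a ≠ ∞ := (ha.trans_le le_top).ne
    obtain ⟨r, hr, hball⟩ := Metric.eventually_nhds_iff.1 (hG q a ha)
    -- For `n ≥ a` the truncation stays above `a` on the ball of radius `r`; for `n ≥ a / r` the
    -- penalty `n * dist` alone exceeds `a` outside it.
    obtain ⟨n₀, hn₀⟩ := exists_nat_ge (max a.toReal (a.toReal / r))
    refine le_liminf_of_le (by isBoundedDefault) ?_
    filter_upwards [eventually_ge_atTop n₀] with n hn
    have hn' : max a.toReal (a.toReal / r) ≤ n := hn₀.trans (by exact_mod_cast hn)
    rw [← ENNReal.ofReal_toReal hatop]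
    refine ENNReal.ofReal_le_ofReal ?_
    have : Nonempty X := ⟨q⟩
    refine le_ciInf fun z => ?_
    rcases lt_or_ge (dist z q) r with hz | hz
    · have h1 : a ≤ min (G z) n := by
        refine le_min (hball hz).le ?_
        rw [← ENNReal.ofReal_toReal hatop, ← ENNReal.ofReal_natCast]
        exact ENNReal.ofReal_le_ofReal ((le_max_left _ _).trans hn')
      have h2 : a.toReal ≤ T n z := ENNReal.toReal_mono
        (ne_top_of_le_ne_top (ENNReal.natCast_ne_top n) (min_le_right _ _)) h1
      have h3 : (0 : ℝ) ≤ n * dist q z := by positivity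
      linarith
    · have h1 : a.toReal / r ≤ n := (le_max_right _ _).trans hn'
      rw [div_le_iff₀ hr] at h1
      have h2 : (n : ℝ) * r ≤ n * dist q z := by
        rw [dist_comm]
        exact mul_le_mul_of_nonneg_left hz n.cast_nonneg
      linarith [hT0 n z]

end Semicontinuity

/-! ### Product measures and their two-point marginals. -/

section Product

variable {X : Type*} [MeasurableSpace X]

theorem lintegral_fin_prod_eq_prod {N : ℕ} {ω : Measure X} [SigmaFinite ω]
    {f : Fin N → X → ℝ≥0∞} (hf : ∀ i, Measurable (f i)) :
    ∫⁻ x : Fin N → X, ∏ i, f i (x i) ∂(Measure.pi fun _ => ω) = ∏ i, ∫⁻ y, f i y ∂ω := by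
  induction N with
  | zero => simp
  | succ N ih =>
    have h := (measurePreserving_piFinSuccAbove (fun _ : Fin (N + 1) => ω) 0).symm
    have hm : Measurable fun x : Fin (N + 1) → X => ∏ i, f i (x i) :=
      Finset.measurable_fun_prod _ fun i _ => (hf i).comp (measurable_pi_apply i)
    rw [← h.lintegral_comp hm]
    simp only [MeasurableEquiv.piFinSuccAbove_symm_apply, Fin.insertNthEquiv_zero,
      Fin.consEquiv_apply, Fin.prod_univ_succ, Fin.cons_zero, Fin.cons_succ]
    rw [lintegral_prod_mul (f := f 0) (g := fun x : Fin N → X => ∏ i : Fin N, f i.succ (x i))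
      (hf 0).aemeasurable (Finset.measurable_fun_prod _ fun i _ =>
        (hf _).comp (measurable_pi_apply i)).aemeasurable]
    congr 1
    exact ih fun i => hf i.succ

theorem pi_withDensity {N : ℕ} {ω : Measure X} [SigmaFinite ω] {φ : X → ℝ≥0∞}
    (hφ : Measurable φ) [SigmaFinite (ω.withDensity φ)] :
    (Measure.pi fun _ : Fin N => ω.withDensity φ) =
      (Measure.pi fun _ : Fin N => ω).withDensity fun x => ∏ i, φ (x i) := by
  refine Measure.pi_eq fun s hs => ?_
  rw [withDensity_apply _ (MeasurableSet.univ_pi hs), ← lintegral_indicator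
    (MeasurableSet.univ_pi hs)]
  have h1 : ∀ x : Fin N → X, (Set.univ.pi s).indicator (fun x => ∏ i, φ (x i)) x =
      ∏ i, (s i).indicator φ (x i) := by
    intro x
    by_cases hx : x ∈ Set.univ.pi s
    · rw [Set.indicator_of_mem hx]
      exact Finset.prod_congr rfl fun i _ => (Set.indicator_of_mem (hx i (Set.mem_univ i)) _).symm
    · rw [Set.indicator_of_notMem hx]
      simp only [Set.mem_univ_pi, not_forall] at hx
      obtain ⟨i, hi⟩ := hx
      exact (Finset.prod_eq_zero (Finset.mem_univ i) (Set.indicator_of_notMem hi _)).symm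
  simp_rw [h1]
  rw [lintegral_fin_prod_eq_prod fun i => hφ.indicator (hs i)]
  refine Finset.prod_congr rfl fun i _ => ?_
  rw [lintegral_indicator (hs i), withDensity_apply _ (hs i)]

theorem map_eval_pair_pi {N : ℕ} (μ : Measure X) [IsProbabilityMeasure μ] {i j : Fin N}
    (hij : i ≠ j) :
    (Measure.pi fun _ : Fin N => μ).map (fun x => (x i, x j)) = μ.prod μ := by
  have h := ProbabilityTheory.iIndepFun_pi (μ := fun _ : Fin N => μ) (X := fun _ => (id : X → X))
    fun _ => aemeasurable_id
  have h2 := (ProbabilityTheory.indepFun_iff_map_prod_eq_prod_map_map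
    (measurable_pi_apply i).aemeasurable (measurable_pi_apply j).aemeasurable).1 (h.indepFun hij)
  refine h2.trans ?_
  congr 1
  · exact (measurePreserving_eval (fun _ : Fin N => μ) i).map_eq
  · exact (measurePreserving_eval (fun _ : Fin N => μ) j).map_eq

end Product

/-! ### The weighted kernel and the consequences of the assumptions. -/

section Kernel

variable {M : Type*}

/-- The non-negative kernel `g(x, z) + ϑ(x) + ϑ(z)`. -/
def weightedKernel (g : M → M → EReal) (θ : M → ℝ) (x z : M) : ℝ≥0∞ :=
  (g x z + ((θ x + θ z : ℝ) : EReal)).toENNReal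

theorem exp_neg_shiftedPotential (V : M → EReal) (θ : M → ℝ) (κ : ℝ) (x : M) :
    EReal.exp (-shiftedPotential V θ κ x) =
      EReal.exp (-V x) * ENNReal.ofReal (Real.exp (κ * θ x)) := by
  rw [shiftedPotential, EReal.neg_sub (Or.inr (EReal.coe_ne_bot _)) (Or.inr (EReal.coe_ne_top _)), EReal.exp_add, EReal.exp_coe]

variable [MetricSpace M] [MeasurableSpace M] {n : ℕ} {ω : Measure M} {g : M → M → EReal}
  {V : M → EReal} {θ : M → ℝ}

namespace Assumptions

theorem zero_le_add (hass : Assumptions n ω g V θ) (x z : M) :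
    0 ≤ g x z + ((θ x + θ z : ℝ) : EReal) := by
  have h := hass.neg_kernel_le x z
  rw [EReal.neg_le] at h
  calc (0 : EReal) = -((θ x + θ z : ℝ) : EReal) + ((θ x + θ z : ℝ) : EReal) := by
        rw [← EReal.coe_neg, ← EReal.coe_add]
        simp
    _ ≤ _ := add_le_add_left h _

theorem coe_weightedKernel (hass : Assumptions n ω g V θ) (x z : M) :
    (weightedKernel g θ x z : EReal) = g x z + ((θ x + θ z : ℝ) : EReal) :=
  EReal.coe_toENNReal (hass.zero_le_add x z)

theorem kernel_eq (hass : Assumptions n ω g V θ) (x z : M) :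
    g x z = (weightedKernel g θ x z : EReal) - ((θ x + θ z : ℝ) : EReal) := by
  rw [hass.coe_weightedKernel, EReal.add_sub_cancel_right]

theorem weightedKernel_symm (hass : Assumptions n ω g V θ) (x z : M) :
    weightedKernel g θ x z = weightedKernel g θ z x := by
  rw [weightedKernel, weightedKernel, hass.symm x z, add_comm (θ x)]

theorem weightedKernel_eq_top_iff (hass : Assumptions n ω g V θ) (x z : M) :
    weightedKernel g θ x z = ∞ ↔ g x z = ⊤ := by
  rw [← EReal.coe_ennreal_eq_top_iff, hass.coe_weightedKernel]
  induction h : g x z with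
  | bot => exact absurd h (hass.kernel_ne_bot x z)
  | top => simp
  | coe a => simp [← EReal.coe_add]

theorem toReal_kernel (hass : Assumptions n ω g V θ) {x z : M} (h : g x z ≠ ⊤) :
    (g x z).toReal = (weightedKernel g θ x z).toReal - (θ x + θ z) := by
  have h1 := hass.kernel_eq x z
  have h2 : weightedKernel g θ x z ≠ ∞ := fun h3 => h ((hass.weightedKernel_eq_top_iff x z).1 h3)
  rw [h1, EReal.toReal_sub (by simpa using h2) (EReal.coe_ennreal_ne_bot _) (EReal.coe_ne_top _)
    (EReal.coe_ne_bot _), EReal.toReal_coe_ennreal, EReal.toReal_coe]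

theorem lowerSemicontinuous_weightedKernel (hass : Assumptions n ω g V θ) :
    LowerSemicontinuous fun q : M × M => weightedKernel g θ q.1 q.2 := by
  have h1 : LowerSemicontinuous fun q : M × M =>
      g q.1 q.2 + ((θ q.1 + θ q.2 : ℝ) : EReal) := by
    refine hass.lsc.add' (Continuous.lowerSemicontinuous ?_) fun q => ?_
    · have := hass.theta_continuous
      exact continuous_coe_real_ereal.comp (by fun_prop)
    · exact EReal.continuousAt_add (Or.inr (EReal.coe_ne_bot _)) (Or.inr (EReal.coe_ne_top _))
  intro q a ha
  have h2 := h1 q (a : EReal) ?_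
  · filter_upwards [h2] with q' hq'
    rw [gt_iff_lt, ← EReal.coe_ennreal_lt_coe_ennreal_iff]
    rwa [hass.coe_weightedKernel]
  · simp only [← hass.coe_weightedKernel]
    exact EReal.coe_ennreal_lt_coe_ennreal_iff.2 ha

theorem lintegral_weight_lt_top (hass : Assumptions n ω g V θ) {κ : ℝ} (hκ : 0 ≤ κ) :
    ∫⁻ x, EReal.exp (-V x) * ENNReal.ofReal (Real.exp (κ * θ x)) ∂ω < ∞ := by
  simp_rw [← exp_neg_shiftedPotential]
  exact (hass.confining κ hκ).integrable

theorem exists_weight_le (hass : Assumptions n ω g V θ) {κ : ℝ} (hκ : 0 ≤ κ) :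
    ∃ B : ℝ≥0, ∀ x, EReal.exp (-V x) * ENNReal.ofReal (Real.exp (κ * θ x)) ≤ B := by
  obtain ⟨c, hc⟩ := (hass.confining κ hκ).bddBelow
  refine ⟨(Real.exp (-c)).toNNReal, fun x => ?_⟩
  rw [← exp_neg_shiftedPotential]
  change _ ≤ ENNReal.ofReal (Real.exp (-c))
  rw [← EReal.exp_coe, EReal.exp_le_exp_iff, EReal.coe_neg]
  exact EReal.neg_le_neg_iff.2 (hc x)

variable [BorelSpace M]

theorem measurable_theta (hass : Assumptions n ω g V θ) : Measurable θ :=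
  hass.theta_continuous.measurable

theorem measurable_potential (hass : Assumptions n ω g V θ) : Measurable V := by
  have h := hass.confining 0 le_rfl
  have hV : shiftedPotential V θ 0 = V := by
    ext x
    simp [shiftedPotential]
  rw [hV] at h
  classical
  have h1 : V = {x | V x < ⊤}.piecewise V fun _ => ⊤ := by
    ext x
    by_cases hx : V x < ⊤
    · exact (Set.piecewise_eq_of_mem {x | V x < ⊤} V (fun _ => ⊤) hx).symm
    · rw [Set.piecewise_eq_of_notMem {x | V x < ⊤} V (fun _ => ⊤) hx]
      exact not_lt_top_iff.1 hx
  rw [h1]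
  exact h.continuousOn.measurable_piecewise continuousOn_const h.isOpen.measurableSet

theorem measurable_exp_neg_potential (hass : Assumptions n ω g V θ) :
    Measurable fun x => EReal.exp (-V x) :=
  hass.measurable_potential.neg.ereal_exp

theorem measurable_weight (hass : Assumptions n ω g V θ) (κ : ℝ) :
    Measurable fun x => EReal.exp (-V x) * ENNReal.ofReal (Real.exp (κ * θ x)) :=
  hass.measurable_exp_neg_potential.mul (hass.measurable_theta.const_mul κ).exp.ennreal_ofReal

variable [SecondCountableTopology M]

theorem measurable_weightedKernel (hass : Assumptions n ω g V θ) :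
    Measurable fun q : M × M => weightedKernel g θ q.1 q.2 :=
  hass.lowerSemicontinuous_weightedKernel.measurable

theorem measurable_kernel (hass : Assumptions n ω g V θ) :
    Measurable fun q : M × M => g q.1 q.2 :=
  hass.lsc.measurable

/-- For a measure with bounded density, the kernel splits as a continuous part bounded from above
and a non-negative part with uniformly small integrals. -/
theorem exists_splitting (hass : Assumptions n ω g V θ) {ρ : Measure M} [IsProbabilityMeasure ρ]
    {D : ℝ≥0} (hρ : ρ ≤ D • ω) {ε : ℝ} (hε : 0 < ε) :
    ∃ (k : ℝ) (gc : M → M → ℝ) (gs : M → M → ℝ≥0∞), 0 ≤ k ∧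
      (∀ u x, g u x = (gc u x : EReal) + (gs u x : EReal)) ∧ (∀ u x, gc u x ≤ k) ∧
      Continuous (fun q : M × M => gc q.1 q.2) ∧ (∀ u, Measurable (gs u)) ∧
      ∀ u, ∫⁻ x, gs u x ∂ρ ≤ ENNReal.ofReal ε := by
  obtain ⟨gc, gs, p, c, hp, hc, hk⟩ := hass.decomposition
  have hp0 : 0 < p := zero_lt_one.trans hp
  have hlim : Tendsto (fun k => (D * c k) ^ (1 / p)) atTop (𝓝 0) := by
    have h1 := (hc.const_mul D).nnrpow (tendsto_const_nhds (x := 1 / p)) (Or.inr (by positivity))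
    rwa [mul_zero, NNReal.zero_rpow (by positivity)] at h1
  obtain ⟨k, hk1, hkε⟩ := ((eventually_ge_atTop 1).and
    (hlim.eventually_lt_const (Real.toNNReal_pos.2 hε))).exists
  obtain ⟨hdec, hle, hcont, hint⟩ := hk k hk1
  -- Measurability of the singular part is not assumed; it is inherited from `g` and the continuous
  -- part by subtraction.
  have hmeas : ∀ u, Measurable (gs k u) := by
    intro u
    have h1 : gs k u = fun x => (g u x - (gc k u x : EReal)).toENNReal := by
      ext x
      rw [hdec, add_comm, EReal.add_sub_cancel_right, EReal.toENNReal_coe]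
    rw [h1]
    refine Measurable.ereal_toENNReal ?_
    refine Measurable.sub ?_ ?_
    · exact hass.measurable_kernel.comp measurable_prodMk_left
    · exact (hcont.measurable.comp measurable_prodMk_left).coe_real_ereal
  refine ⟨k, gc k, gs k, k.cast_nonneg, hdec, hle, hcont, hmeas, fun u => ?_⟩
  have h1 : ∫⁻ x, gs k u x ^ p ∂ρ ≤ D * c k := by
    refine (lintegral_mono' hρ le_rfl).trans ?_
    rw [lintegral_smul_measure]
    exact mul_le_mul_right (hint u) _
  -- As `ρ` is a probability measure, the `L¹` norm is at most the `L^p` norm, hence at most `(D * c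
  -- k) ^ (1 / p)`.
  have h2 : eLpNorm (gs k u) 1 ρ ≤ eLpNorm (gs k u) (ENNReal.ofReal p) ρ :=
    eLpNorm_le_eLpNorm_of_exponent_le (by simpa using hp.le) (hmeas u).aestronglyMeasurable
  rw [eLpNorm_one_eq_lintegral_enorm, eLpNorm_eq_lintegral_rpow_enorm_toReal (by simpa using hp0)
    ENNReal.ofReal_ne_top, ENNReal.toReal_ofReal hp0.le] at h2
  simp only [enorm_eq_self] at h2
  refine h2.trans ((ENNReal.rpow_le_rpow h1 (by positivity)).trans ?_)
  rw [← ENNReal.coe_mul, ← ENNReal.coe_rpow_of_nonneg _ (by positivity)]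
  exact ENNReal.coe_le_coe.2 hkε.le

/-- In the splitting with `ε = 1` the continuous part is at most `k` and the singular part
integrates to at most `1`, so `A = k + 1` works. This gives finite potentials at every point, and
finite energy as soon as `θ` is integrable. -/
theorem exists_lintegral_weightedKernel_le (hass : Assumptions n ω g V θ) {ρ : Measure M}
    [IsProbabilityMeasure ρ] {D : ℝ≥0} (hρ : ρ ≤ D • ω) :
    ∃ A : ℝ≥0, ∀ x, ∫⁻ z, weightedKernel g θ x z ∂ρ ≤
      A + ENNReal.ofReal (θ x) + ∫⁻ z, ENNReal.ofReal (θ z) ∂ρ := by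
  obtain ⟨k, gc, gs, hk, hdec, hle, hcont, hmeas, hint⟩ := hass.exists_splitting hρ one_pos
  refine ⟨k.toNNReal + 1, fun x => ?_⟩
  have h1 : ∀ z, weightedKernel g θ x z ≤
      (ENNReal.ofReal k + ENNReal.ofReal (θ x) + ENNReal.ofReal (θ z)) + gs x z := by
    intro z
    rw [← EReal.coe_ennreal_le_coe_ennreal_iff, hass.coe_weightedKernel, hdec,
      ← ENNReal.ofReal_add hk (hass.theta_nonneg x),
      ← ENNReal.ofReal_add (add_nonneg hk (hass.theta_nonneg x)) (hass.theta_nonneg z),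
      EReal.coe_ennreal_add, EReal.coe_ennreal_ofReal, max_eq_left
        (add_nonneg (add_nonneg hk (hass.theta_nonneg x)) (hass.theta_nonneg z)), add_right_comm,
      ← EReal.coe_add]
    refine add_le_add_left (EReal.coe_le_coe_iff.2 ?_) _
    linarith [hle x z]
  calc ∫⁻ z, weightedKernel g θ x z ∂ρ
      ≤ ∫⁻ z, (ENNReal.ofReal k + ENNReal.ofReal (θ x) + ENNReal.ofReal (θ z)) + gs x z ∂ρ :=
        lintegral_mono h1
    _ = ENNReal.ofReal k + ENNReal.ofReal (θ x) + ∫⁻ z, ENNReal.ofReal (θ z) ∂ρ +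
          ∫⁻ z, gs x z ∂ρ := by
        rw [lintegral_add_right _ (hmeas x), lintegral_add_right _ hass.measurable_theta.ennreal_ofReal]
        simp
    _ ≤ _ := by
        refine (add_le_add_right (hint x) _).trans_eq ?_
        rw [ENNReal.ofReal_one, ENNReal.coe_add, ENNReal.coe_one]
        change ENNReal.ofReal k + _ + _ + 1 = ENNReal.ofReal k + 1 + _ + _
        ring

end Assumptions

end Kernel

/-! ### First variation of the free energy. -/

section Minimizer

/-- Divide by `t` and let `t` tend to `0`: the first-order condition at an endpoint minimum, with
`A` the slope and `B` the second-order coefficient. -/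
theorem nonneg_of_forall_mul_add_mul_sq {A B : ℝ}
    (h : ∀ t : ℝ, 0 < t → t < 1 → 0 ≤ t * A + t ^ 2 * B) : 0 ≤ A := by
  refine le_of_forall_pos_le_add fun ε hε => ?_
  set t : ℝ := min (1 / 2) (ε / (|B| + 1)) with ht
  have hB : 0 < |B| + 1 := by positivity
  have ht0 : 0 < t := lt_min (by norm_num) (by positivity)
  have ht1 : t < 1 := (min_le_left _ _).trans_lt (by norm_num)
  have h1 := h t ht0 ht1
  have h2 : 0 ≤ A + t * B := by
    have : t * A + t ^ 2 * B = t * (A + t * B) := by ring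
    rw [this] at h1
    exact nonneg_of_mul_nonneg_right h1 ht0
  have h3 : t * B ≤ ε := by
    have h4 : t * (|B| + 1) ≤ ε := by
      rw [← le_div_iff₀ hB]
      exact min_le_right _ _
    nlinarith [le_abs_self B]
  linarith

variable {M : Type*} [MeasurableSpace M] {g : M → M → EReal} {θ : M → ℝ}

/-- The energy is a quadratic form; Tonelli and the symmetry of the kernel identify the two cross
terms. Everything lives in `[0, ∞]`, so no integrability is required. -/
theorem weightedEnergy_add_smul
    (hm : Measurable fun q : M × M => weightedKernel g θ q.1 q.2)
    (hs : ∀ x z, weightedKernel g θ x z = weightedKernel g θ z x)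
    (μ σ : Measure M) [SFinite μ] [SFinite σ] (s t : ℝ≥0) :
    weightedEnergy g θ (s • μ + t • σ) = s ^ 2 * weightedEnergy g θ μ +
      2 * s * t * ∫⁻ x, ∫⁻ z, weightedKernel g θ x z ∂μ ∂σ + t ^ 2 * weightedEnergy g θ σ := by
  have hm1 : ∀ ρ : Measure M, [SFinite ρ] → Measurable fun x => ∫⁻ z, weightedKernel g θ x z ∂ρ :=
    fun ρ _ => hm.lintegral_prod_right'
  have hswap : ∫⁻ x, ∫⁻ z, weightedKernel g θ x z ∂σ ∂μ =
      ∫⁻ x, ∫⁻ z, weightedKernel g θ x z ∂μ ∂σ := by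
    rw [lintegral_lintegral_swap hm.aemeasurable]
    exact lintegral_congr fun x => lintegral_congr fun z => hs _ _
  change ∫⁻ x, ∫⁻ z, weightedKernel g θ x z ∂(s • μ + t • σ) ∂(s • μ + t • σ) = _
  have hin : ∀ x, ∫⁻ z, weightedKernel g θ x z ∂(s • μ + t • σ) =
      s * ∫⁻ z, weightedKernel g θ x z ∂μ + t * ∫⁻ z, weightedKernel g θ x z ∂σ := by
    intro x
    rw [lintegral_add_measure, lintegral_smul_measure, lintegral_smul_measure]
    rfl
  have hout : ∀ ρ : Measure M, ∫⁻ x, ∫⁻ z, weightedKernel g θ x z ∂(s • μ + t • σ) ∂ρ =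
      s * ∫⁻ x, ∫⁻ z, weightedKernel g θ x z ∂μ ∂ρ +
        t * ∫⁻ x, ∫⁻ z, weightedKernel g θ x z ∂σ ∂ρ := by
    intro ρ
    simp_rw [hin]
    rw [lintegral_add_left ((hm1 μ).const_mul _), lintegral_const_mul _ (hm1 μ),
      lintegral_const_mul _ (hm1 σ)]
  rw [lintegral_add_measure, lintegral_smul_measure, lintegral_smul_measure, hout, hout, hswap]
  change (s : ℝ≥0∞) * (s * weightedEnergy g θ μ + _) + (t : ℝ≥0∞) * (_ + t * weightedEnergy g θ σ) = _
  ring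

variable [MetricSpace M] {n : ℕ} {ω : Measure M} {V : M → EReal} {γ : ℝ}

namespace Assumptions

theorem isProbabilityMeasure_referenceMeasure (hass : Assumptions n ω g V θ) (hγ : 0 ≤ γ)
    (hC : ∫⁻ x, EReal.exp (-shiftedPotential V θ γ x) ∂ω ≠ 0) :
    IsProbabilityMeasure (referenceMeasure ω V θ γ) := by
  constructor
  rw [referenceMeasure, Measure.smul_apply, withDensity_apply _ MeasurableSet.univ,
    Measure.restrict_univ, smul_eq_mul]
  exact ENNReal.inv_mul_cancel hC (hass.confining γ hγ).integrable.ne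

/-- The lower bound on `V - γ θ` is an upper bound on the density. -/
theorem exists_referenceMeasure_le (hass : Assumptions n ω g V θ) (hγ : 0 ≤ γ)
    (hC : ∫⁻ x, EReal.exp (-shiftedPotential V θ γ x) ∂ω ≠ 0) :
    ∃ D : ℝ≥0, referenceMeasure ω V θ γ ≤ D • ω := by
  obtain ⟨B, hB⟩ := hass.exists_weight_le hγ
  refine ⟨(∫⁻ x, EReal.exp (-shiftedPotential V θ γ x) ∂ω)⁻¹.toNNReal * B, ?_⟩
  have h1 : ω.withDensity (fun x => EReal.exp (-shiftedPotential V θ γ x)) ≤ B • ω := by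
    refine (withDensity_mono (ae_of_all _ fun x => ?_)).trans_eq
      (withDensity_const (μ := ω) (B : ℝ≥0∞))
    rw [exp_neg_shiftedPotential]
    exact hB x
  refine Measure.le_iff.2 fun s hs => ?_
  have h2 := Measure.le_iff.1 h1 s hs
  rw [referenceMeasure, Measure.smul_apply, Measure.smul_apply, smul_eq_mul]
  refine (mul_le_mul_right h2 _).trans_eq ?_
  rw [Measure.smul_apply, ENNReal.smul_def, ENNReal.smul_def, ENNReal.coe_mul,
    ENNReal.coe_toNNReal (ENNReal.inv_ne_top.2 hC), smul_eq_mul, smul_eq_mul, mul_assoc]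

variable [BorelSpace M]

theorem lintegral_referenceMeasure (hass : Assumptions n ω g V θ)
    {f : M → ℝ≥0∞} (hf : Measurable f) :
    ∫⁻ x, f x ∂(referenceMeasure ω V θ γ) =
      (∫⁻ x, EReal.exp (-shiftedPotential V θ γ x) ∂ω)⁻¹ *
        ∫⁻ x, EReal.exp (-V x) * ENNReal.ofReal (Real.exp (γ * θ x)) * f x ∂ω := by
  rw [referenceMeasure, lintegral_smul_measure, smul_eq_mul]
  simp_rw [exp_neg_shiftedPotential]
  rw [lintegral_withDensity_eq_lintegral_mul _ (hass.measurable_weight γ) hf]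
  rfl

/-- The factor `exp (κ θ)` replaces `γ` by `γ + κ` in the weight, and the confinement assumption
holds for every parameter. -/
theorem lintegral_exp_theta_referenceMeasure_lt_top (hass : Assumptions n ω g V θ) (hγ : 0 ≤ γ)
    (hC : ∫⁻ x, EReal.exp (-shiftedPotential V θ γ x) ∂ω ≠ 0) {κ : ℝ} (hκ : 0 ≤ κ) :
    ∫⁻ x, ENNReal.ofReal (Real.exp (κ * θ x)) ∂(referenceMeasure ω V θ γ) < ∞ := by
  rw [hass.lintegral_referenceMeasure (hass.measurable_theta.const_mul κ).exp.ennreal_ofReal]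
  refine ENNReal.mul_lt_top (ENNReal.inv_lt_top.2 (pos_iff_ne_zero.2 hC)) ?_
  refine lt_of_le_of_lt (le_of_eq ?_) (hass.lintegral_weight_lt_top (add_nonneg hγ hκ))
  refine lintegral_congr fun x => ?_
  rw [mul_assoc, ← ENNReal.ofReal_mul (Real.exp_pos _).le, ← Real.exp_add, add_mul]

theorem lintegral_theta_referenceMeasure_lt_top (hass : Assumptions n ω g V θ) (hγ : 0 ≤ γ)
    (hC : ∫⁻ x, EReal.exp (-shiftedPotential V θ γ x) ∂ω ≠ 0) :
    ∫⁻ x, ENNReal.ofReal (θ x) ∂(referenceMeasure ω V θ γ) < ∞ := by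
  refine lt_of_le_of_lt (lintegral_mono fun x => ENNReal.ofReal_le_ofReal ?_)
    (hass.lintegral_exp_theta_referenceMeasure_lt_top hγ hC zero_le_one)
  have := Real.add_one_le_exp (θ x)
  rw [one_mul]
  linarith

variable [SecondCountableTopology M]

theorem weightedEnergy_referenceMeasure_ne_top (hass : Assumptions n ω g V θ) (hγ : 0 ≤ γ)
    (hC : ∫⁻ x, EReal.exp (-shiftedPotential V θ γ x) ∂ω ≠ 0)
    [IsProbabilityMeasure (referenceMeasure ω V θ γ)] :
    weightedEnergy g θ (referenceMeasure ω V θ γ) ≠ ∞ := by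
  obtain ⟨D, hD⟩ := hass.exists_referenceMeasure_le hγ hC
  obtain ⟨A, hA⟩ := hass.exists_lintegral_weightedKernel_le hD
  have hθ := hass.lintegral_theta_referenceMeasure_lt_top hγ hC
  refine ((lintegral_mono fun x => hA x).trans_lt ?_).ne
  rw [lintegral_add_right _ measurable_const, lintegral_add_left measurable_const]
  simp [hθ]

/-- The self-consistency equation for a minimizer of the free energy. -/
theorem minimizer_eq_tilted (hass : Assumptions n ω g V θ) (hγ : 0 ≤ γ)
    (hC : ∫⁻ x, EReal.exp (-shiftedPotential V θ γ x) ∂ω ≠ 0)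
    {μ : ProbabilityMeasure M}
    (hmin : ∀ ρ : ProbabilityMeasure M, freeEnergy ω g V θ γ μ ≤ freeEnergy ω g V θ γ ρ) :
    klDiv (μ : Measure M) (referenceMeasure ω V θ γ) ≠ ∞ ∧ Integrable θ (μ : Measure M) ∧
    (μ : Measure M) = (referenceMeasure ω V θ γ).tilted fun x =>
      -γ * (∫⁻ z, weightedKernel g θ x z ∂(μ : Measure M)).toReal := by
  have hνp := hass.isProbabilityMeasure_referenceMeasure hγ hC
  set ν := referenceMeasure ω V θ γ with hν
  have hEν := hass.weightedEnergy_referenceMeasure_ne_top hγ hC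
  have hFν : freeEnergy ω g V θ γ ⟨ν, hνp⟩ ≠ ∞ := by
    simp only [freeEnergy, ProbabilityMeasure.coe_mk, ← hν, klDiv_self, add_zero]
    exact ENNReal.mul_ne_top ENNReal.ofReal_ne_top hEν
  have hFμ : freeEnergy ω g V θ γ μ ≠ ∞ := ne_top_of_le_ne_top hFν (hmin _)
  have hkl : klDiv (μ : Measure M) ν ≠ ∞ := fun h => hFμ (by rw [freeEnergy, ← hν, h, add_top])
  have hθμ : Integrable θ (μ : Measure M) := integrable_of_klDiv_ne_top hkl hass.measurable_theta
    hass.theta_nonneg (by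
      simpa using hass.lintegral_exp_theta_referenceMeasure_lt_top hγ hC zero_le_one)
  refine ⟨hkl, hθμ, ?_⟩
  -- For `γ = 0` only the entropy remains, and comparison with `ν` gives `μ = ν`. This case is
  -- separate because finite free energy bounds the interaction energy only for `γ > 0`.
  rcases hγ.eq_or_lt with hγ0 | hγ0
  · have h1 := hmin ⟨ν, hνp⟩
    have h2 : ENNReal.ofReal (γ / 2) = 0 := by simp [← hγ0]
    simp only [freeEnergy, ProbabilityMeasure.coe_mk, ← hν, klDiv_self, h2, zero_mul, zero_add,
      nonpos_iff_eq_zero] at h1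
    rw [klDiv_eq_zero_iff] at h1
    rw [h1, ← hγ0]
    simp
  have hm := hass.measurable_weightedKernel
  set P : M → ℝ≥0∞ := fun x => ∫⁻ z, weightedKernel g θ x z ∂(μ : Measure M) with hP
  have hPm : Measurable P := hm.lintegral_prod_right'
  have hEμ : ∫⁻ x, P x ∂(μ : Measure M) ≠ ∞ := by
    intro h
    refine hFμ ?_
    rw [freeEnergy]
    change ENNReal.ofReal (γ / 2) * ∫⁻ x, P x ∂(μ : Measure M) + _ = _
    rw [h, ENNReal.mul_top (by simpa using hγ0), top_add]
  -- No density bound on `μ` is available yet. Tonelli exchanges the roles: the potential of `ν` is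
  -- at most a constant plus `θ`, which `μ` integrates.
  have hPν : ∫⁻ x, P x ∂ν ≠ ∞ := by
    obtain ⟨D, hD⟩ := hass.exists_referenceMeasure_le hγ hC
    obtain ⟨A, hA⟩ := hass.exists_lintegral_weightedKernel_le hD
    have hθ := hass.lintegral_theta_referenceMeasure_lt_top hγ hC
    simp only [hP]
    rw [lintegral_lintegral_swap hm.aemeasurable]
    refine ((lintegral_mono fun x => (lintegral_congr fun z =>
      hass.weightedKernel_symm z x).trans_le (hA x)).trans_lt ?_).ne
    rw [lintegral_add_right _ measurable_const, lintegral_add_left measurable_const]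
    have h2 := (hasFiniteIntegral_iff_ofReal (ae_of_all _ hass.theta_nonneg)).1 hθμ.2
    rw [← hν] at hθ
    simp [hθ, h2, ← hν]
  set f : M → ℝ := fun x => -γ * (P x).toReal with hf
  have hfm : Measurable f := hPm.ennreal_toReal.const_mul _
  have hf0 : ∀ x, f x ≤ 0 := fun x => by
    have : 0 ≤ γ * (P x).toReal := mul_nonneg hγ ENNReal.toReal_nonneg
    simp only [hf]
    linarith
  have hfν : Integrable (fun x => Real.exp (f x)) ν := by
    refine Integrable.of_bound hfm.exp.aestronglyMeasurable 1 (ae_of_all _ fun x => ?_)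
    rw [Real.norm_eq_abs, abs_of_pos (Real.exp_pos _)]
    exact Real.exp_le_one_iff.2 (hf0 x)
  set σ := ν.tilted f with hσ
  have hσp : IsProbabilityMeasure σ := isProbabilityMeasure_tilted hfν
  set Z := ∫ x, Real.exp (f x) ∂ν with hZ
  have hZ0 : 0 < Z := integral_exp_pos hfν
  -- The exponent is non-positive, so tilting multiplies the density by at most `1 / Z`; the finite
  -- energies of `ν` pass to `σ`.
  have hσν : σ ≤ (Z⁻¹).toNNReal • ν := by
    rw [hσ, Measure.tilted]
    refine (withDensity_mono (ae_of_all _ fun x => ?_)).trans_eq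
      (withDensity_const (μ := ν) (((Z⁻¹).toNNReal : ℝ≥0) : ℝ≥0∞))
    refine ENNReal.ofReal_le_ofReal ?_
    rw [← one_div]
    exact div_le_div_of_nonneg_right (Real.exp_le_one_iff.2 (hf0 x)) hZ0.le
  have hPσ : ∫⁻ x, P x ∂σ ≠ ∞ := by
    refine ne_top_of_le_ne_top ?_ (lintegral_mono' hσν le_rfl)
    rw [lintegral_smul_measure]
    exact ENNReal.mul_ne_top ENNReal.coe_ne_top hPν
  have hEσ : weightedEnergy g θ σ ≠ ∞ := by
    have h1 : weightedEnergy g θ σ ≤ weightedEnergy g θ ((Z⁻¹).toNNReal • ν) :=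
      lintegral_mono' hσν fun x => lintegral_mono' hσν le_rfl
    refine ne_top_of_le_ne_top ?_ h1
    have h2 := weightedEnergy_add_smul hm hass.weightedKernel_symm ν 0 (Z⁻¹).toNNReal 0
    rw [smul_zero, add_zero] at h2
    rw [h2]
    simpa using ENNReal.mul_ne_top (ENNReal.pow_ne_top (n := 2) (ENNReal.coe_ne_top (r := (Z⁻¹).toNNReal))) hEν
  have hσac : σ ≪ ν := tilted_absolutelyContinuous ν f
  have hμac : (μ : Measure M) ≪ ν := (klDiv_ne_top_iff.1 hkl).1
  have hPint : ∀ ρ : Measure M, ∫⁻ x, P x ∂ρ ≠ ∞ → Integrable f ρ := fun ρ h =>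
    (integrable_toReal_of_lintegral_ne_top hPm.aemeasurable h).const_mul _
  have hPf : ∀ ρ : Measure M, ∫⁻ x, P x ∂ρ ≠ ∞ →
      ∫ x, f x ∂ρ = -γ * (∫⁻ x, P x ∂ρ).toReal := fun ρ h => by
    simp only [hf]
    rw [integral_const_mul, integral_toReal hPm.aemeasurable (ae_lt_top hPm h)]
  have hllrσ : llr σ ν =ᵐ[σ] fun x => f x - Real.log Z :=
    hσac.ae_le (log_rnDeriv_tilted_left_self hfν)
  have hklσ : klDiv σ ν ≠ ∞ := klDiv_ne_top hσac
    ((integrable_congr hllrσ).2 ((hPint σ hPσ).sub (integrable_const _)))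
  have hklσ_eq : (klDiv σ ν).toReal = -γ * (∫⁻ x, P x ∂σ).toReal - Real.log Z := by
    rw [toReal_klDiv_of_measure_eq hσac (by simp), integral_congr_ae hllrσ,
      integral_sub (hPint σ hPσ) (integrable_const _), hPf σ hPσ]
    simp
  have hllr := (klDiv_ne_top_iff.1 hkl).2
  have hμσ : (μ : Measure M) ≪ σ := hμac.trans (absolutelyContinuous_tilted hfν)
  have hklμσ : klDiv (μ : Measure M) σ ≠ ∞ :=
    klDiv_ne_top hμσ (integrable_llr_tilted_right hμac (hPint _ hEμ) hllr hfν)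
  have hklμσ_eq : (klDiv (μ : Measure M) σ).toReal = (klDiv (μ : Measure M) ν).toReal +
      γ * (∫⁻ x, P x ∂(μ : Measure M)).toReal + Real.log Z := by
    rw [toReal_klDiv_of_measure_eq hμσ (by simp), toReal_klDiv_of_measure_eq hμac (by simp),
      integral_llr_tilted_right hμac (hPint _ hEμ) hfν hllr, hPf _ hEμ]
    ring
  -- Minimality along `(1 - t) μ + t σ`: the energy contributes its exact expansion, with `B` its
  -- coefficient of `t²`, while convexity bounds the entropy increment by a term linear in `t`.
  have hvar : 0 ≤ γ * ((∫⁻ x, P x ∂σ).toReal - (∫⁻ x, P x ∂(μ : Measure M)).toReal) +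
      ((klDiv σ ν).toReal - (klDiv (μ : Measure M) ν).toReal) := by
    refine nonneg_of_forall_mul_add_mul_sq (B := γ / 2 * ((∫⁻ x, P x ∂(μ : Measure M)).toReal -
      2 * (∫⁻ x, P x ∂σ).toReal + (weightedEnergy g θ σ).toReal)) fun t ht0 ht1 => ?_
    lift t to ℝ≥0 using ht0.le
    have ht1' : t ≤ 1 := by exact_mod_cast ht1.le
    set s : ℝ≥0 := 1 - t with hs
    have hst : s + t = 1 := tsub_add_cancel_of_le ht1'
    have hsr : (s : ℝ) = 1 - t := by rw [hs, NNReal.coe_sub ht1', NNReal.coe_one]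
    have hp : IsProbabilityMeasure (s • (μ : Measure M) + t • σ) := ⟨by
      simp only [Measure.coe_add, Measure.coe_smul, Pi.add_apply, Pi.smul_apply, measure_univ,
        ENNReal.smul_def, smul_eq_mul, mul_one]
      exact_mod_cast hst⟩
    have h1 := (hmin ⟨_, hp⟩).trans (add_le_add_right (klDiv_add_smul_le hμac hσac hst) _)
    rw [freeEnergy, ProbabilityMeasure.coe_mk,
      weightedEnergy_add_smul hm hass.weightedKernel_symm] at h1
    change ENNReal.ofReal (γ / 2) * (∫⁻ x, P x ∂(μ : Measure M)) + klDiv (μ : Measure M) ν ≤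
      ENNReal.ofReal (γ / 2) * (s ^ 2 * (∫⁻ x, P x ∂(μ : Measure M)) +
        2 * s * t * (∫⁻ x, P x ∂σ) + t ^ 2 * weightedEnergy g θ σ) + _ at h1
    rw [← ENNReal.ofReal_toReal hEμ, ← ENNReal.ofReal_toReal hPσ, ← ENNReal.ofReal_toReal hEσ,
      ← ENNReal.ofReal_toReal hkl, ← ENNReal.ofReal_toReal hklσ] at h1
    have h2 := ENNReal.toReal_mono (by finiteness) h1
    rw [ENNReal.toReal_add (by finiteness) (by finiteness),
      ENNReal.toReal_add (by finiteness) (by finiteness),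
      ENNReal.toReal_add (by finiteness) (by finiteness), ENNReal.toReal_mul, ENNReal.toReal_mul,
      ENNReal.toReal_add (by finiteness) (by finiteness),
      ENNReal.toReal_add (by finiteness) (by finiteness)] at h2
    simp only [ENNReal.toReal_mul, ENNReal.toReal_pow, ENNReal.toReal_ofReal ENNReal.toReal_nonneg,
      ENNReal.coe_toReal, ENNReal.toReal_ofReal (half_pos hγ0).le, ENNReal.toReal_ofNat, hsr] at h2
    nlinarith
  -- Inserting the entropy of `σ` cancels `γ ∫ P dσ`; what remains in `hvar` is `-H(μ|σ) ≥ 0`.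
  have hzero : (klDiv (μ : Measure M) σ).toReal ≤ 0 := by
    rw [hklσ_eq] at hvar
    rw [hklμσ_eq]
    linarith
  have h0 : klDiv (μ : Measure M) σ = 0 := by
    have := le_antisymm hzero ENNReal.toReal_nonneg
    exact (ENNReal.toReal_eq_zero_iff _).1 this |>.resolve_right hklμσ
  exact klDiv_eq_zero_iff.1 h0

end Assumptions

end Minimizer

/-! ### Potentials of measures with bounded density; the Euler-Lagrange equation. -/

section Potential

variable {M : Type*} [MetricSpace M] [MeasurableSpace M] [BorelSpace M]
  [SecondCountableTopology M] {n : ℕ} {ω : Measure M} {g : M → M → EReal} {V : M → EReal}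
  {θ : M → ℝ} {γ : ℝ} {ρ : Measure M} [IsProbabilityMeasure ρ] {D : ℝ≥0}

namespace Assumptions

theorem measurable_weightedKernel_right (hass : Assumptions n ω g V θ) (x : M) :
    Measurable (weightedKernel g θ x) :=
  hass.measurable_weightedKernel.comp measurable_prodMk_left

theorem measurable_lintegral_weightedKernel (hass : Assumptions n ω g V θ) :
    Measurable fun x => ∫⁻ z, weightedKernel g θ x z ∂ρ :=
  hass.measurable_weightedKernel.lintegral_prod_right'

theorem lintegral_weightedKernel_ne_top (hass : Assumptions n ω g V θ) (hρ : ρ ≤ D • ω)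
    (hθ : Integrable θ ρ) (x : M) : ∫⁻ z, weightedKernel g θ x z ∂ρ ≠ ∞ := by
  obtain ⟨A, hA⟩ := hass.exists_lintegral_weightedKernel_le hρ
  have h := (hasFiniteIntegral_iff_ofReal (ae_of_all _ hass.theta_nonneg)).1 hθ.2
  refine ne_top_of_le_ne_top ?_ (hA x)
  simp [h.ne]

theorem weightedEnergy_ne_top (hass : Assumptions n ω g V θ) (hρ : ρ ≤ D • ω)
    (hθ : Integrable θ ρ) : ∫⁻ x, ∫⁻ z, weightedKernel g θ x z ∂ρ ∂ρ ≠ ∞ := by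
  obtain ⟨A, hA⟩ := hass.exists_lintegral_weightedKernel_le hρ
  have h := (hasFiniteIntegral_iff_ofReal (ae_of_all _ hass.theta_nonneg)).1 hθ.2
  refine ((lintegral_mono hA).trans_lt ?_).ne
  rw [lintegral_add_right _ measurable_const, lintegral_add_left measurable_const]
  simp [h]

theorem ae_kernel_ne_top (hass : Assumptions n ω g V θ) (hρ : ρ ≤ D • ω)
    (hθ : Integrable θ ρ) (x : M) : ∀ᵐ z ∂ρ, g x z ≠ ⊤ := by
  filter_upwards [ae_lt_top (hass.measurable_weightedKernel_right x)
    (hass.lintegral_weightedKernel_ne_top hρ hθ x)] with z hz h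
  exact hz.ne ((hass.weightedKernel_eq_top_iff x z).2 h)

theorem kernel_toReal_ae_eq (hass : Assumptions n ω g V θ) (hρ : ρ ≤ D • ω)
    (hθ : Integrable θ ρ) (x : M) : (fun z => (g x z).toReal) =ᵐ[ρ]
      fun z => (weightedKernel g θ x z).toReal - (θ x + θ z) := by
  filter_upwards [hass.ae_kernel_ne_top hρ hθ x] with z hz
  exact hass.toReal_kernel hz

theorem integrable_toReal_weightedKernel (hass : Assumptions n ω g V θ) (hρ : ρ ≤ D • ω)
    (hθ : Integrable θ ρ) (x : M) : Integrable (fun z => (weightedKernel g θ x z).toReal) ρ :=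
  integrable_toReal_of_lintegral_ne_top (hass.measurable_weightedKernel_right x).aemeasurable
    (hass.lintegral_weightedKernel_ne_top hρ hθ x)

theorem integrable_kernel (hass : Assumptions n ω g V θ) (hρ : ρ ≤ D • ω)
    (hθ : Integrable θ ρ) (x : M) : Integrable (fun z => (g x z).toReal) ρ :=
  (integrable_congr (hass.kernel_toReal_ae_eq hρ hθ x)).2
    ((hass.integrable_toReal_weightedKernel hρ hθ x).sub ((integrable_const _).add hθ))

theorem potential_eq (hass : Assumptions n ω g V θ) (hρ : ρ ≤ D • ω)
    (hθ : Integrable θ ρ) (x : M) :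
    potential g ρ x = (∫⁻ z, weightedKernel g θ x z ∂ρ).toReal - θ x - ∫ z, θ z ∂ρ := by
  have hi : Integrable (fun z => θ x + θ z) ρ := (integrable_const _).add hθ
  rw [potential, integral_congr_ae (hass.kernel_toReal_ae_eq hρ hθ x),
    integral_sub (hass.integrable_toReal_weightedKernel hρ hθ x) hi,
    integral_add (integrable_const _) hθ,
    integral_toReal (hass.measurable_weightedKernel_right x).aemeasurable
      (ae_lt_top (hass.measurable_weightedKernel_right x)
        (hass.lintegral_weightedKernel_ne_top hρ hθ x))]
  simp
  ring

/-- The potential of a measure with bounded density is continuous. -/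
theorem continuous_potential (hass : Assumptions n ω g V θ) (hρ : ρ ≤ D • ω)
    (hθ : Integrable θ ρ) : Continuous (potential g ρ) := by
  have hfin := hass.lintegral_weightedKernel_ne_top hρ hθ
  refine continuous_iff_continuousAt.2 fun x₀ => ?_
  refine Metric.tendsto_nhds.2 fun ε hε => ?_
  -- Lower half: Fatou applied to the weighted kernel, together with continuity of `θ`. The case
  -- distinction is there because `ENNReal.ofReal` truncates negative thresholds.
  have hlow : ∀ᶠ x in 𝓝 x₀, potential g ρ x₀ - ε < potential g ρ x := by
    have hlsc : LowerSemicontinuous fun x => ∫⁻ z, weightedKernel g θ x z ∂ρ :=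
      lowerSemicontinuous_lintegral hass.measurable_weightedKernel_right fun z =>
        hass.lowerSemicontinuous_weightedKernel.comp (Continuous.prodMk_left z)
    rcases lt_or_ge ((∫⁻ z, weightedKernel g θ x₀ z ∂ρ).toReal - ε / 2) 0 with h0 | h0
    · filter_upwards [hass.theta_continuous.continuousAt.eventually_lt_const
        (show θ x₀ < θ x₀ + ε / 2 by linarith)] with x hx
      rw [hass.potential_eq hρ hθ, hass.potential_eq hρ hθ]
      have : 0 ≤ (∫⁻ z, weightedKernel g θ x z ∂ρ).toReal := ENNReal.toReal_nonneg
      linarith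
    · have h1 : ENNReal.ofReal ((∫⁻ z, weightedKernel g θ x₀ z ∂ρ).toReal - ε / 2) <
          ∫⁻ z, weightedKernel g θ x₀ z ∂ρ := by
        rw [ENNReal.ofReal_lt_iff_lt_toReal h0 (hfin x₀)]
        linarith
      filter_upwards [hlsc x₀ _ h1, hass.theta_continuous.continuousAt.eventually_lt_const
        (show θ x₀ < θ x₀ + ε / 2 by linarith)] with x hx hx2
      rw [hass.potential_eq hρ hθ, hass.potential_eq hρ hθ]
      rw [gt_iff_lt, ENNReal.ofReal_lt_iff_lt_toReal h0 (hfin x)] at hx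
      linarith
  -- Upper half: Fatou applied to `k - gc ≥ 0`, whose integral `Q` is `k - U` up to the singular
  -- part; that part costs at most `ε / 2`, uniformly in `x`.
  have hup : ∀ᶠ x in 𝓝 x₀, potential g ρ x < potential g ρ x₀ + ε := by
    obtain ⟨k, gc, gs, hk, hdec, hle, hcont, hmeas, hint⟩ :=
      hass.exists_splitting hρ (half_pos hε)
    set Q : M → ℝ≥0∞ := fun x => ∫⁻ z, ENNReal.ofReal (k - gc x z) ∂ρ with hQ
    have hQm : ∀ x, Measurable fun z => k - gc x z := fun x =>
      (hcont.measurable.comp measurable_prodMk_left).const_sub k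
    have hgsfin : ∀ x, ∫⁻ z, gs x z ∂ρ ≠ ∞ := fun x =>
      ne_top_of_le_ne_top ENNReal.ofReal_ne_top (hint x)
    have hgsi : ∀ x, Integrable (fun z => (gs x z).toReal) ρ := fun x =>
      integrable_toReal_of_lintegral_ne_top (hmeas x).aemeasurable (hgsfin x)
    have hae : ∀ x, (fun z => k - gc x z) =ᵐ[ρ] fun z => k - (g x z).toReal + (gs x z).toReal := by
      intro x
      filter_upwards [ae_lt_top (hmeas x) (hgsfin x)] with z hz
      rw [hdec, EReal.toReal_add (EReal.coe_ne_top _) (EReal.coe_ne_bot _) (by simpa using hz.ne)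
        (EReal.coe_ennreal_ne_bot _), EReal.toReal_coe, EReal.toReal_coe_ennreal]
      ring
    have hi : ∀ x, Integrable (fun z => k - gc x z) ρ := fun x =>
      (integrable_congr (hae x)).2
        (((integrable_const _).sub (hass.integrable_kernel hρ hθ x)).add (hgsi x))
    have hQeq : ∀ x, Q x = ENNReal.ofReal (∫ z, (k - gc x z) ∂ρ) := fun x =>
      (ofReal_integral_eq_lintegral_ofReal (hi x)
        (ae_of_all _ fun z => sub_nonneg.2 (hle x z))).symm
    have hQr : ∀ x, (Q x).toReal = k - potential g ρ x + (∫⁻ z, gs x z ∂ρ).toReal := by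
      intro x
      have hi2 : Integrable (fun z => k - (g x z).toReal) ρ :=
        (integrable_const _).sub (hass.integrable_kernel hρ hθ x)
      rw [hQeq, ENNReal.toReal_ofReal (integral_nonneg fun z => sub_nonneg.2 (hle x z)),
        integral_congr_ae (hae x),
        integral_add hi2 (hgsi x),
        integral_sub (integrable_const _) (hass.integrable_kernel hρ hθ x),
        integral_toReal (hmeas x).aemeasurable (ae_lt_top (hmeas x) (hgsfin x)), potential]
      simp
    have hQfin : ∀ x, Q x ≠ ∞ := fun x => by
      rw [hQeq]
      exact ENNReal.ofReal_ne_top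
    have hlsc : LowerSemicontinuous Q := by
      refine lowerSemicontinuous_lintegral (fun x => (hQm x).ennreal_ofReal) fun z => ?_
      exact (ENNReal.continuous_ofReal.comp (continuous_const.sub
        (hcont.comp (Continuous.prodMk_left z)))).lowerSemicontinuous
    have hgsle : ∀ x, (∫⁻ z, gs x z ∂ρ).toReal ≤ ε / 2 := fun x =>
      ENNReal.toReal_le_of_le_ofReal (half_pos hε).le (hint x)
    rcases lt_or_ge ((Q x₀).toReal - ε / 2) 0 with h0 | h0
    · refine Eventually.of_forall fun x => ?_
      have h1 : 0 ≤ (Q x).toReal := ENNReal.toReal_nonneg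
      have h2 : 0 ≤ (∫⁻ z, gs x₀ z ∂ρ).toReal := ENNReal.toReal_nonneg
      linarith [hQr x, hQr x₀, hgsle x]
    · have h1 : ENNReal.ofReal ((Q x₀).toReal - ε / 2) < Q x₀ := by
        rw [ENNReal.ofReal_lt_iff_lt_toReal h0 (hQfin x₀)]
        linarith
      filter_upwards [hlsc x₀ _ h1] with x hx
      rw [gt_iff_lt, ENNReal.ofReal_lt_iff_lt_toReal h0 (hQfin x)] at hx
      have h2 : 0 ≤ (∫⁻ z, gs x₀ z ∂ρ).toReal := ENNReal.toReal_nonneg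
      linarith [hQr x, hQr x₀, hgsle x]
  filter_upwards [hlow, hup] with x h1 h2
  rw [Real.dist_eq, abs_lt]
  constructor <;> linarith

theorem integrable_toReal_lintegral_weightedKernel (hass : Assumptions n ω g V θ)
    (hρ : ρ ≤ D • ω) (hθ : Integrable θ ρ) :
    Integrable (fun x => (∫⁻ z, weightedKernel g θ x z ∂ρ).toReal) ρ :=
  integrable_toReal_of_lintegral_ne_top hass.measurable_lintegral_weightedKernel.aemeasurable
    (hass.weightedEnergy_ne_top hρ hθ)

theorem integrable_potential (hass : Assumptions n ω g V θ) (hρ : ρ ≤ D • ω)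
    (hθ : Integrable θ ρ) : Integrable (potential g ρ) ρ := by
  have h : potential g ρ = fun x =>
      (∫⁻ z, weightedKernel g θ x z ∂ρ).toReal - θ x - ∫ z, θ z ∂ρ := by
    ext x
    exact hass.potential_eq hρ hθ x
  rw [h]
  exact ((hass.integrable_toReal_lintegral_weightedKernel hρ hθ).sub hθ).sub (integrable_const _)

theorem integral_potential (hass : Assumptions n ω g V θ) (hρ : ρ ≤ D • ω)
    (hθ : Integrable θ ρ) : ∫ x, potential g ρ x ∂ρ =
      (∫⁻ x, ∫⁻ z, weightedKernel g θ x z ∂ρ ∂ρ).toReal - 2 * ∫ z, θ z ∂ρ := by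
  have hi := hass.integrable_toReal_lintegral_weightedKernel hρ hθ
  have hi2 : Integrable (fun x => (∫⁻ z, weightedKernel g θ x z ∂ρ).toReal - θ x) ρ := hi.sub hθ
  simp_rw [hass.potential_eq hρ hθ]
  rw [integral_sub hi2 (integrable_const _), integral_sub hi hθ,
    integral_toReal hass.measurable_lintegral_weightedKernel.aemeasurable
      (ae_of_all _ fun x => (hass.lintegral_weightedKernel_ne_top hρ hθ x).lt_top)]
  simp
  ring

/-- The tilting exponent is non-positive, so the bounded density of the reference measure passes to
the minimizer. All results on measures with `ρ ≤ D • ω` then apply to it. -/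
theorem minimizer_le_smul (hass : Assumptions n ω g V θ) (hγ : 0 ≤ γ)
    (hC : ∫⁻ x, EReal.exp (-shiftedPotential V θ γ x) ∂ω ≠ 0)
    {μ : ProbabilityMeasure M}
    (hmin : ∀ ρ : ProbabilityMeasure M, freeEnergy ω g V θ γ μ ≤ freeEnergy ω g V θ γ ρ) :
    ∃ D : ℝ≥0, (μ : Measure M) ≤ D • ω := by
  have hνp := hass.isProbabilityMeasure_referenceMeasure hγ hC
  obtain ⟨D, hD⟩ := hass.exists_referenceMeasure_le hγ hC
  obtain ⟨-, -, hμ⟩ := hass.minimizer_eq_tilted hγ hC hmin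
  set f : M → ℝ := fun x => -γ * (∫⁻ z, weightedKernel g θ x z ∂(μ : Measure M)).toReal with hf
  set Z := ∫ x, Real.exp (f x) ∂(referenceMeasure ω V θ γ) with hZ
  have hf0 : ∀ x, f x ≤ 0 := fun x => by
    have : 0 ≤ γ * (∫⁻ z, weightedKernel g θ x z ∂(μ : Measure M)).toReal :=
      mul_nonneg hγ ENNReal.toReal_nonneg
    simp only [hf]
    linarith
  have h1 : (μ : Measure M) ≤ (Z⁻¹).toNNReal • referenceMeasure ω V θ γ := by
    rw [hμ, Measure.tilted]
    refine (withDensity_mono (ae_of_all _ fun x => ?_)).trans_eq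
      (withDensity_const (((Z⁻¹).toNNReal : ℝ≥0) : ℝ≥0∞))
    refine ENNReal.ofReal_le_ofReal ?_
    rw [← one_div]
    exact div_le_div_of_nonneg_right (Real.exp_le_one_iff.2 (hf0 x))
      (integral_nonneg fun x => (Real.exp_pos _).le)
  refine ⟨(Z⁻¹).toNNReal * D, h1.trans (Measure.le_iff.2 fun s hs => ?_)⟩
  rw [mul_smul, Measure.smul_apply, Measure.smul_apply (Z⁻¹).toNNReal (D • ω)]
  simp only [ENNReal.smul_def, smul_eq_mul]
  exact mul_le_mul_right (Measure.le_iff.1 hD s hs) _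

/-- The Euler-Lagrange equation for the density of a minimizer, with the value of the minimum. -/
theorem exists_minimizer_eq_withDensity (hass : Assumptions n ω g V θ) (hγ : 0 ≤ γ)
    (hC : ∫⁻ x, EReal.exp (-shiftedPotential V θ γ x) ∂ω ≠ 0)
    {μ : ProbabilityMeasure M}
    (hmin : ∀ ρ : ProbabilityMeasure M, freeEnergy ω g V θ γ μ ≤ freeEnergy ω g V θ γ ρ) :
    ∃ L : ℝ, 0 < L ∧ ((μ : Measure M) = ω.withDensity fun x => ENNReal.ofReal L⁻¹ *
        EReal.exp (-(((γ * potential g (μ : Measure M) x : ℝ) : EReal) + V x))) ∧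
      freeEnergy ω g V θ γ μ = ENNReal.ofReal
        (Real.log (∫⁻ x, EReal.exp (-shiftedPotential V θ γ x) ∂ω).toReal - Real.log L -
          γ / 2 * ∫ x, potential g (μ : Measure M) x ∂(μ : Measure M)) := by
  have hνp := hass.isProbabilityMeasure_referenceMeasure hγ hC
  obtain ⟨D, hD⟩ := hass.minimizer_le_smul hγ hC hmin
  obtain ⟨hkl, hθ, hμ⟩ := hass.minimizer_eq_tilted hγ hC hmin
  set C := ∫⁻ x, EReal.exp (-shiftedPotential V θ γ x) ∂ω with hCdef
  have hCtop : C ≠ ∞ := (hass.confining γ hγ).integrable.ne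
  have hC0 : 0 < C.toReal := ENNReal.toReal_pos hC hCtop
  set P : M → ℝ≥0∞ := fun x => ∫⁻ z, weightedKernel g θ x z ∂(μ : Measure M) with hP
  have hPm : Measurable P := hass.measurable_lintegral_weightedKernel
  set f : M → ℝ := fun x => -γ * (P x).toReal with hf
  have hfm : Measurable f := hPm.ennreal_toReal.const_mul _
  set ν := referenceMeasure ω V θ γ with hν
  have hf0 : ∀ x, f x ≤ 0 := fun x => by
    have : 0 ≤ γ * (P x).toReal := mul_nonneg hγ ENNReal.toReal_nonneg
    simp only [hf]
    linarith
  have hfν : Integrable (fun x => Real.exp (f x)) ν := by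
    refine Integrable.of_bound hfm.exp.aestronglyMeasurable 1 (ae_of_all _ fun x => ?_)
    rw [Real.norm_eq_abs, abs_of_pos (Real.exp_pos _)]
    exact Real.exp_le_one_iff.2 (hf0 x)
  set Z := ∫ x, Real.exp (f x) ∂ν with hZ
  have hZ0 : 0 < Z := integral_exp_pos hfν
  set τ := ∫ z, θ z ∂(μ : Measure M) with hτ
  have hU : ∀ x, potential g (μ : Measure M) x = (P x).toReal - θ x - τ := fun x =>
    hass.potential_eq hD hθ x
  -- `C` normalizes `ν` and `Z` the tilt. Writing `P = U + θ + τ`, the term in `θ` cancels the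
  -- weight `exp (γ θ)` of `ν`, and `τ` leaves the constant `exp (γ τ)`.
  refine ⟨C.toReal * Z * Real.exp (γ * τ), by positivity, ?_, ?_⟩
  · have hνeq : ν = C⁻¹ • ω.withDensity
        fun x => EReal.exp (-V x) * ENNReal.ofReal (Real.exp (γ * θ x)) := by
      simp only [hν, referenceMeasure, hCdef, exp_neg_shiftedPotential]
    conv_lhs => rw [hμ, Measure.tilted, ← hZ, hνeq, withDensity_smul_measure]
    rw [← withDensity_mul _ (hass.measurable_weight γ) (hfm.exp.div_const Z).ennreal_ofReal,
      ← withDensity_smul _ ((hass.measurable_weight γ).mul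
        (hfm.exp.div_const Z).ennreal_ofReal)]
    congr 1
    ext x
    simp only [Pi.smul_apply, Pi.mul_apply, smul_eq_mul]
    rw [EReal.neg_add (Or.inl (EReal.coe_ne_bot _)) (Or.inl (EReal.coe_ne_top _)), sub_eq_add_neg,
      EReal.exp_add, ← EReal.coe_neg, EReal.exp_coe,
      show C⁻¹ = ENNReal.ofReal C.toReal⁻¹ by
        rw [ENNReal.ofReal_inv_of_pos hC0, ENNReal.ofReal_toReal hCtop]]
    have h1 : Real.exp (γ * θ x) * (Real.exp (f x) / Z) * C.toReal⁻¹ =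
        (C.toReal * Z * Real.exp (γ * τ))⁻¹ *
          Real.exp (-(γ * potential g (μ : Measure M) x)) := by
      rw [hU, show -(γ * ((P x).toReal - θ x - τ)) = γ * θ x + f x + γ * τ by
        simp only [hf]; ring, Real.exp_add, Real.exp_add]
      field_simp
    have h2 : ENNReal.ofReal (Real.exp (γ * θ x)) * ENNReal.ofReal (Real.exp (f x) / Z) *
        ENNReal.ofReal C.toReal⁻¹ = ENNReal.ofReal (C.toReal * Z * Real.exp (γ * τ))⁻¹ *
          ENNReal.ofReal (Real.exp (-(γ * potential g (μ : Measure M) x))) := by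
      rw [← ENNReal.ofReal_mul (by positivity), ← ENNReal.ofReal_mul (by positivity),
        ← ENNReal.ofReal_mul (by positivity), h1]
    rw [← mul_assoc (ENNReal.ofReal (C.toReal * Z * Real.exp (γ * τ))⁻¹), ← h2]
    ring
  -- The entropy equals `-γ E - log Z` with `E` the weighted energy, so the minimum is `-γ/2 E - log
  -- Z`; then `E = ∫ U dμ + 2 τ` is substituted.
  · have hac : (μ : Measure M) ≪ ν := (klDiv_ne_top_iff.1 hkl).1
    have hE := hass.weightedEnergy_ne_top hD hθ
    have hllr : llr (μ : Measure M) ν =ᵐ[(μ : Measure M)] fun x => f x - Real.log Z := by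
      have h1 := log_rnDeriv_tilted_left_self hfν
      rw [← hμ] at h1
      exact hac.ae_le h1
    have hfi : Integrable f (μ : Measure M) :=
      (hass.integrable_toReal_lintegral_weightedKernel hD hθ).const_mul _
    have h1 : (klDiv (μ : Measure M) ν).toReal =
        -γ * (∫⁻ x, P x ∂(μ : Measure M)).toReal - Real.log Z := by
      rw [toReal_klDiv_of_measure_eq hac (by simp), integral_congr_ae hllr,
        integral_sub hfi (integrable_const _)]
      simp only [hf]
      rw [integral_const_mul, integral_toReal hPm.aemeasurable (ae_lt_top hPm hE)]
      simp
    have hw : weightedEnergy g θ (μ : Measure M) = ∫⁻ x, P x ∂(μ : Measure M) := rfl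
    rw [freeEnergy, hw, ← hν, ← ENNReal.ofReal_toReal hkl, ← ENNReal.ofReal_toReal hE,
      ← ENNReal.ofReal_mul (by positivity), ← ENNReal.ofReal_add (by positivity) (by positivity), h1,
      hass.integral_potential hD hθ, Real.log_mul (by positivity) (by positivity),
      Real.log_mul hC0.ne' hZ0.ne', Real.log_exp]
    congr 1
    ring

end Assumptions

end Potential

/-! ### Bounds on Boltzmann factors. -/

section Configurations

variable {M : Type*} {g : M → M → EReal} {V : M → EReal} {θ : M → ℝ}

/-- Negation distributes over an `EReal` sum only when `⊥ + ⊤` is excluded, so both claims go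
through the same induction. -/
theorem sum_ne_bot_and_exp_neg_sum {ι : Type*} (s : Finset ι) {v : ι → EReal}
    (hv : ∀ i, v i ≠ ⊥) :
    ∑ i ∈ s, v i ≠ ⊥ ∧ EReal.exp (-∑ i ∈ s, v i) = ∏ i ∈ s, EReal.exp (-v i) := by
  classical
  induction s using Finset.induction_on with
  | empty => simp
  | insert a s ha ih =>
    rw [Finset.sum_insert ha, Finset.prod_insert ha, ← ih.2]
    refine ⟨EReal.add_ne_bot_iff.2 ⟨hv a, ih.1⟩, ?_⟩
    rw [EReal.neg_add (Or.inl (hv a)) (Or.inr ih.1), sub_eq_add_neg, EReal.exp_add]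

theorem coe_sum_ereal {ι : Type*} (s : Finset ι) (v : ι → ℝ) :
    ((∑ i ∈ s, v i : ℝ) : EReal) = ∑ i ∈ s, (v i : EReal) :=
  map_sum (⟨⟨Real.toEReal, EReal.coe_zero⟩, EReal.coe_add⟩ : ℝ →+ EReal) v s

theorem exp_neg_coe_add_sum {N : ℕ} (hV : ∀ x, V x ≠ ⊥) (r : ℝ) (x : Fin N → M) :
    EReal.exp (-((r : EReal) + ∑ j, V (x j))) =
      ENNReal.ofReal (Real.exp (-r)) * ∏ j, EReal.exp (-V (x j)) := by
  rw [EReal.neg_add (Or.inl (EReal.coe_ne_bot _)) (Or.inl (EReal.coe_ne_top _)), sub_eq_add_neg,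
    EReal.exp_add, ← EReal.coe_neg, EReal.exp_coe,
    (sum_ne_bot_and_exp_neg_sum Finset.univ fun j => hV (x j)).2]

theorem exp_neg_energy_le {N : ℕ} (hV : ∀ x, V x ≠ ⊥) {β : ℝ} (hβ : 0 ≤ β) (x : Fin N → M)
    {r : Fin N → Fin N → ℝ} (hr : ∀ i j, (r i j : EReal) ≤ g (x i) (x j)) :
    EReal.exp (-energy β g V x) ≤ ENNReal.ofReal (Real.exp (-(β * ∑ i, ∑ j ∈ Finset.Ioi i, r i j))) *
      ∏ j, EReal.exp (-V (x j)) := by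
  rw [← exp_neg_coe_add_sum hV, EReal.exp_le_exp_iff, EReal.neg_le_neg_iff, energy]
  refine add_le_add_left ?_ _
  rw [EReal.coe_mul]
  refine mul_le_mul_of_nonneg_left ?_ (EReal.coe_nonneg.2 hβ)
  simp_rw [coe_sum_ereal]
  exact Finset.sum_le_sum fun i _ => Finset.sum_le_sum fun j _ => hr i j

theorem exp_neg_energy_eq {N : ℕ} (hV : ∀ x, V x ≠ ⊥) (hg : ∀ x z, g x z ≠ ⊥) (β : ℝ)
    (x : Fin N → M) (hx : ∀ i j, i < j → g (x i) (x j) ≠ ⊤) :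
    EReal.exp (-energy β g V x) =
      ENNReal.ofReal (Real.exp (-(β * ∑ i, ∑ j ∈ Finset.Ioi i, (g (x i) (x j)).toReal))) *
        ∏ j, EReal.exp (-V (x j)) := by
  rw [← exp_neg_coe_add_sum hV, energy]
  congr 4
  rw [EReal.coe_mul]
  congr 1
  simp_rw [coe_sum_ereal]
  refine Finset.sum_congr rfl fun i _ => Finset.sum_congr rfl fun j hj => ?_
  exact (EReal.coe_toReal (hx i j (Finset.mem_Ioi.1 hj)) (hg _ _)).symm

theorem sum_sum_Ioi_add {N : ℕ} (f : Fin N → Fin N → ℝ) :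
    ∑ i, ∑ j ∈ Finset.Ioi i, (f i j + f j i) = ∑ i, ∑ j, f i j - ∑ i, f i i := by
  have h := Finset.sum_sum_Ioi_add_eq_sum_sum_off_diag (fun i j => f i j)
  rw [← Finset.sum_sub_distrib]
  trans ∑ i, ∑ j ∈ {i}ᶜ, f j i
  · rw [← h]
    refine Finset.sum_congr rfl fun i _ => Finset.sum_congr rfl fun j hj => ?_
    ring
  · have h2 : ∀ i, ∑ j ∈ {i}ᶜ, f j i = ∑ j, f j i - f i i := fun i => by
      rw [← Finset.sum_add_sum_compl {i} (fun j => f j i)]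
      simp
    simp_rw [h2, Finset.sum_sub_distrib]
    rw [Finset.sum_comm]

theorem sum_sum_Ioi_const {N : ℕ} (c : ℝ) :
    ∑ i : Fin N, ∑ _j ∈ Finset.Ioi i, c = N * (N - 1) / 2 * c := by
  have h := sum_sum_Ioi_add (N := N) fun _ _ => c / 2
  simp only [add_halves, Finset.sum_const, Finset.card_univ, Fintype.card_fin, nsmul_eq_mul] at h ⊢
  rw [h]
  ring

variable [MetricSpace M] [MeasurableSpace M] {n : ℕ} {ω : Measure M}

namespace Assumptions

/-- Completing the sum over pairs to the full double sum adds the diagonal, at a cost of at most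
`β/2 * N * b`, and each `θ (x i)` occurs in `N - 1` pairs. Up to the factor `N²`, the double sum is
the integral of `K` against the square of the empirical measure. -/
theorem exp_neg_energy_le_of_le (hass : Assumptions n ω g V θ) {N : ℕ} {β : ℝ} (hβ : 0 ≤ β)
    {K : M × M → ℝ} {b : ℝ} (hK0 : ∀ q, 0 ≤ K q) (hKb : ∀ q, K q ≤ b)
    (hK : ∀ q, ENNReal.ofReal (K q) ≤ weightedKernel g θ q.1 q.2) (x : Fin N → M) :
    EReal.exp (-energy β g V x) ≤
      ENNReal.ofReal (Real.exp (-(β / 2 * ∑ i, ∑ j, K (x i, x j)) + β / 2 * N * b +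
        β * (N - 1) * ∑ i, θ (x i))) * ∏ j, EReal.exp (-V (x j)) := by
  have hle : ∀ u v, ((K (u, v) - (θ u + θ v) : ℝ) : EReal) ≤ g u v := by
    intro u v
    rw [hass.kernel_eq u v, EReal.coe_sub]
    refine EReal.sub_le_sub ?_ le_rfl
    have := EReal.coe_ennreal_le_coe_ennreal_iff.2 (hK (u, v))
    rwa [EReal.coe_ennreal_ofReal, max_eq_left (hK0 _)] at this
  -- `K` need not be symmetric. Its symmetrization is still a lower bound, as an average is at most
  -- the larger of the two values and `g` is symmetric.
  refine (exp_neg_energy_le hass.potential_ne_bot hβ x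
    (r := fun i j => (K (x i, x j) / 2 - θ (x i)) + (K (x j, x i) / 2 - θ (x j)))
    fun i j => ?_).trans ?_
  · have h1 := hle (x i) (x j)
    have h2 := hle (x j) (x i)
    rw [hass.symm (x j) (x i)] at h2
    rcases le_total (K (x i, x j)) (K (x j, x i)) with h | h
    · refine le_trans (EReal.coe_le_coe_iff.2 ?_) h2
      linarith
    · refine le_trans (EReal.coe_le_coe_iff.2 ?_) h1
      linarith
  · refine mul_le_mul_left (ENNReal.ofReal_le_ofReal (Real.exp_le_exp.2 ?_)) _
    rw [sum_sum_Ioi_add fun i j => K (x i, x j) / 2 - θ (x i)]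
    simp only [Finset.sum_sub_distrib, Finset.sum_const, Finset.card_univ, Fintype.card_fin,
      nsmul_eq_mul, ← Finset.sum_div, ← Finset.mul_sum]
    have h1 : ∑ i, K (x i, x i) ≤ N * b := by
      refine (Finset.sum_le_sum fun i _ => hKb (x i, x i)).trans_eq ?_
      simp
    nlinarith

end Assumptions

theorem ofReal_exp_integral_le_lintegral {Ω : Type*} [MeasurableSpace Ω] {P : Measure Ω}
    [IsProbabilityMeasure P] {S : Ω → ℝ} (hS : Integrable S P) :
    ENNReal.ofReal (Real.exp (∫ x, S x ∂P)) ≤ ∫⁻ x, ENNReal.ofReal (Real.exp (S x)) ∂P := by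
  by_cases h : ∫⁻ x, ENNReal.ofReal (Real.exp (S x)) ∂P = ∞
  · rw [h]
    exact le_top
  have hi : Integrable (fun x => Real.exp (S x)) P := (lintegral_ofReal_ne_top_iff_integrable
    (Real.continuous_exp.comp_aestronglyMeasurable hS.1)
    (ae_of_all _ fun x => (Real.exp_pos _).le)).1 h
  rw [← ofReal_integral_eq_lintegral_ofReal hi (ae_of_all _ fun x => (Real.exp_pos _).le)]
  refine ENNReal.ofReal_le_ofReal ?_
  exact convexOn_exp.map_integral_le Real.continuous_exp.continuousOn isClosed_univ
    (ae_of_all _ fun _ => Set.mem_univ _) hS hi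

end Configurations

/-! ### Lower bound for the partition function. -/

section LowerBound

variable {M : Type*} [MetricSpace M] [MeasurableSpace M] [BorelSpace M]
  [SecondCountableTopology M] {n : ℕ} {ω : Measure M} {g : M → M → EReal} {V : M → EReal}
  {θ : M → ℝ} {γ : ℝ} {ρ : Measure M} [IsProbabilityMeasure ρ] {D : ℝ≥0}

namespace Assumptions

theorem ae_prod_kernel_ne_top (hass : Assumptions n ω g V θ) (hρ : ρ ≤ D • ω)
    (hθ : Integrable θ ρ) : ∀ᵐ q ∂(ρ.prod ρ), g q.1 q.2 ≠ ⊤ := by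
  have h : ∫⁻ q, weightedKernel g θ q.1 q.2 ∂(ρ.prod ρ) ≠ ∞ := by
    rw [lintegral_prod _ hass.measurable_weightedKernel.aemeasurable]
    exact hass.weightedEnergy_ne_top hρ hθ
  filter_upwards [ae_lt_top hass.measurable_weightedKernel h] with q hq h2
  exact hq.ne ((hass.weightedKernel_eq_top_iff _ _).2 h2)

theorem integrable_kernel_prod (hass : Assumptions n ω g V θ) (hρ : ρ ≤ D • ω)
    (hθ : Integrable θ ρ) : Integrable (fun q : M × M => (g q.1 q.2).toReal) (ρ.prod ρ) := by
  have h : ∫⁻ q, weightedKernel g θ q.1 q.2 ∂(ρ.prod ρ) ≠ ∞ := by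
    rw [lintegral_prod _ hass.measurable_weightedKernel.aemeasurable]
    exact hass.weightedEnergy_ne_top hρ hθ
  have h1 : (fun q : M × M => (g q.1 q.2).toReal) =ᵐ[ρ.prod ρ]
      fun q => (weightedKernel g θ q.1 q.2).toReal - (θ q.1 + θ q.2) := by
    filter_upwards [hass.ae_prod_kernel_ne_top hρ hθ] with q hq
    exact hass.toReal_kernel hq
  refine (integrable_congr h1).2 (Integrable.sub ?_ (Integrable.add ?_ ?_))
  · exact integrable_toReal_of_lintegral_ne_top hass.measurable_weightedKernel.aemeasurable h
  · exact hθ.comp_fst ρ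
  · exact hθ.comp_snd ρ

theorem integral_kernel_pi (hass : Assumptions n ω g V θ) (hρ : ρ ≤ D • ω)
    (hθ : Integrable θ ρ) {N : ℕ} {i j : Fin N} (hij : i ≠ j) :
    Integrable (fun x : Fin N → M => (g (x i) (x j)).toReal) (Measure.pi fun _ => ρ) ∧
      ∫ x : Fin N → M, (g (x i) (x j)).toReal ∂(Measure.pi fun _ => ρ) =
        ∫ x, potential g ρ x ∂ρ := by
  have hi := hass.integrable_kernel_prod hρ hθ
  have hp : Measurable fun x : Fin N → M => (x i, x j) := by fun_prop
  have h1 := hi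
  rw [← map_eval_pair_pi ρ hij] at h1
  refine ⟨h1.comp_measurable hp, ?_⟩
  have h2 := integral_map hp.aemeasurable h1.1
  rw [map_eval_pair_pi ρ hij, integral_prod _ hi] at h2
  exact h2.symm

/-- Lower bound for the partition function by Jensen's inequality. -/
theorem le_partitionFunction (hass : Assumptions n ω g V θ) [SigmaFinite ω] (hρ : ρ ≤ D • ω)
    (hθ : Integrable θ ρ) {L : ℝ} (hL : 0 < L)
    (hdens : ρ = ω.withDensity fun x => ENNReal.ofReal L⁻¹ *
        EReal.exp (-(((γ * potential g ρ x : ℝ) : EReal) + V x))) (N : ℕ) (β : ℝ) :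
    ENNReal.ofReal (Real.exp (N * Real.log L + γ * N * ∫ x, potential g ρ x ∂ρ -
      β * (N * (N - 1) / 2 * ∫ x, potential g ρ x ∂ρ))) ≤ partitionFunction N ω β g V := by
  set U := potential g ρ with hU
  set φ : M → ℝ≥0∞ := fun x => ENNReal.ofReal L⁻¹ *
    EReal.exp (-(((γ * U x : ℝ) : EReal) + V x)) with hφ
  have hUm : Measurable U := (hass.continuous_potential hρ hθ).measurable
  -- The density equation solved for `exp (-V)`; it also holds where `V = ⊤`, both sides being `0`.
  have hφeq : ∀ x, EReal.exp (-V x) = φ x * ENNReal.ofReal (Real.exp (γ * U x + Real.log L)) := by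
    intro x
    simp only [hφ]
    rw [EReal.neg_add (Or.inl (EReal.coe_ne_bot _)) (Or.inl (EReal.coe_ne_top _)), sub_eq_add_neg,
      EReal.exp_add, ← EReal.coe_neg, EReal.exp_coe]
    have h1 : ENNReal.ofReal L⁻¹ * ENNReal.ofReal (Real.exp (-(γ * U x))) *
        ENNReal.ofReal (Real.exp (γ * U x + Real.log L)) = 1 := by
      rw [← ENNReal.ofReal_mul (by positivity), ← ENNReal.ofReal_mul (by positivity),
        Real.exp_add, Real.exp_log hL, Real.exp_neg, ← ENNReal.ofReal_one]
      congr 1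
      field_simp
    calc EReal.exp (-V x) = EReal.exp (-V x) * 1 := (mul_one _).symm
      _ = _ := by
        rw [← h1]
        ring
  have hφm : Measurable φ := by
    refine Measurable.const_mul (Measurable.ereal_exp (Measurable.neg ?_)) _
    exact (hUm.const_mul γ).coe_real_ereal.add hass.measurable_potential
  have hσ : SigmaFinite (ω.withDensity φ) := hdens ▸ inferInstance
  have hpi : (Measure.pi fun _ : Fin N => ρ) =
      (Measure.pi fun _ : Fin N => ω).withDensity fun x => ∏ i, φ (x i) := by
    rw [← pi_withDensity hφm, ← hdens]
  -- The logarithm of the Boltzmann factor relative to the product density: `Z_N` dominates the mean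
  -- of `exp S` under the product of copies of `ρ`, to which Jensen applies.
  set S : (Fin N → M) → ℝ := fun x => -(β * ∑ i, ∑ j ∈ Finset.Ioi i, (g (x i) (x j)).toReal) +
    ∑ i, (γ * U (x i) + Real.log L) with hS
  have hSm : Measurable S := by
    refine Measurable.add (Measurable.neg (Measurable.const_mul ?_ _)) ?_
    · refine Finset.measurable_fun_sum _ fun i _ => Finset.measurable_fun_sum _ fun j _ => ?_
      have h1 : Measurable fun x : Fin N → M => (x i, x j) := by fun_prop
      exact (hass.measurable_kernel.comp h1).ereal_toReal
    · exact Finset.measurable_fun_sum _ fun i _ =>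
        ((hUm.comp (measurable_pi_apply i)).const_mul γ).add_const _
  have hUi := hass.integrable_potential hρ hθ
  have hUpi : ∀ i : Fin N, Integrable (fun x : Fin N → M => γ * U (x i) + Real.log L)
      (Measure.pi fun _ => ρ) := fun i =>
    ((integrable_comp_eval (μ := fun _ : Fin N => ρ) hUi).const_mul γ).add (integrable_const _)
  have hgpi : ∀ i, ∀ j ∈ Finset.Ioi i, Integrable (fun x : Fin N → M => (g (x i) (x j)).toReal)
      (Measure.pi fun _ => ρ) := fun i j hj =>
    (hass.integral_kernel_pi hρ hθ (Finset.mem_Ioi.1 hj).ne).1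
  have hgsum : Integrable (fun x : Fin N → M =>
      -(β * ∑ i, ∑ j ∈ Finset.Ioi i, (g (x i) (x j)).toReal)) (Measure.pi fun _ => ρ) :=
    ((integrable_finsetSum _ fun i _ => integrable_finsetSum _ (hgpi i)).const_mul β).neg
  have hUsum : Integrable (fun x : Fin N → M => ∑ i, (γ * U (x i) + Real.log L))
      (Measure.pi fun _ => ρ) := integrable_finsetSum _ fun i _ => hUpi i
  have hSint : ∫ x, S x ∂(Measure.pi fun _ : Fin N => ρ) = N * Real.log L +
      γ * N * ∫ x, U x ∂ρ - β * (N * (N - 1) / 2 * ∫ x, U x ∂ρ) := by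
    simp only [hS]
    rw [integral_add hgsum hUsum, integral_neg, integral_const_mul, integral_finsetSum _
      (fun i _ => integrable_finsetSum _ (hgpi i)), integral_finsetSum _ (fun i _ => hUpi i)]
    have h1 : ∀ i : Fin N, ∫ x : Fin N → M, ∑ j ∈ Finset.Ioi i, (g (x i) (x j)).toReal
        ∂(Measure.pi fun _ => ρ) = ∑ j ∈ Finset.Ioi i, ∫ x, U x ∂ρ := by
      intro i
      rw [integral_finsetSum _ (hgpi i)]
      exact Finset.sum_congr rfl fun j hj =>
        (hass.integral_kernel_pi hρ hθ (Finset.mem_Ioi.1 hj).ne).2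
    have h2 : ∀ i : Fin N, ∫ x : Fin N → M, (γ * U (x i) + Real.log L)
        ∂(Measure.pi fun _ => ρ) = γ * ∫ x, U x ∂ρ + Real.log L := by
      intro i
      rw [integral_add ((integrable_comp_eval (μ := fun _ : Fin N => ρ) hUi).const_mul γ)
        (integrable_const _), integral_const_mul,
        integral_comp_eval (μ := fun _ : Fin N => ρ) hUi.1]
      simp [hU]
    simp_rw [h1, h2]
    rw [sum_sum_Ioi_const]
    simp
    ring
  rw [← hSint]
  refine (ofReal_exp_integral_le_lintegral (hgsum.add hUsum)).trans ?_
  -- Off `A`, `toReal` turns an infinite interaction into `0` and `S` is no longer the right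
  -- logarithm; `A` has full measure for the product of copies of `ρ`.
  set A : Set (Fin N → M) := {x | ∀ i j, i < j → g (x i) (x j) ≠ ⊤} with hA
  have hAm : MeasurableSet A := by
    simp only [hA, Set.ofPred_forall]
    refine MeasurableSet.iInter fun i => MeasurableSet.iInter fun j => MeasurableSet.iInter
      fun _ => ?_
    have h1 : Measurable fun x : Fin N → M => (x i, x j) := by fun_prop
    exact (hass.measurable_kernel.comp h1) (measurableSet_singleton ⊤).compl
  have hAae : ∀ᵐ x ∂(Measure.pi fun _ : Fin N => ρ), x ∈ A := by
    simp only [hA, Set.mem_ofPred_eq]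
    refine ae_all_iff.2 fun i => ae_all_iff.2 fun j => ae_all_iff.2 fun hij => ?_
    have hp : Measurable fun x : Fin N → M => (x i, x j) := by fun_prop
    have h1 := hass.ae_prod_kernel_ne_top hρ hθ
    rw [← map_eval_pair_pi ρ hij.ne] at h1
    exact ae_of_ae_map hp.aemeasurable h1
  calc ∫⁻ x, ENNReal.ofReal (Real.exp (S x)) ∂(Measure.pi fun _ : Fin N => ρ)
      = ∫⁻ x, A.indicator (fun x => ENNReal.ofReal (Real.exp (S x))) x
          ∂(Measure.pi fun _ : Fin N => ρ) := by
        refine lintegral_congr_ae ?_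
        filter_upwards [hAae] with x hx
        rw [Set.indicator_of_mem hx]
    _ = ∫⁻ x, (∏ i, φ (x i)) * A.indicator (fun x => ENNReal.ofReal (Real.exp (S x))) x
          ∂(Measure.pi fun _ : Fin N => ω) := by
        rw [hpi, lintegral_withDensity_eq_lintegral_mul _ _
          (hSm.exp.ennreal_ofReal.indicator hAm)]
        · rfl
        · exact Finset.measurable_fun_prod _ fun i _ => hφm.comp (measurable_pi_apply i)
    _ ≤ partitionFunction N ω β g V := by
        refine lintegral_mono fun x => ?_
        by_cases hx : x ∈ A
        · rw [Set.indicator_of_mem hx, exp_neg_energy_eq hass.potential_ne_bot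
            hass.kernel_ne_bot β x hx]
          have h1 : ∏ i, EReal.exp (-V (x i)) = (∏ i, φ (x i)) *
              ENNReal.ofReal (Real.exp (∑ i, (γ * U (x i) + Real.log L))) := by
            rw [Real.exp_sum, ENNReal.ofReal_prod_of_nonneg fun i _ => (Real.exp_pos _).le,
              ← Finset.prod_mul_distrib]
            exact Finset.prod_congr rfl fun i _ => hφeq _
          rw [h1, hS, Real.exp_add, ENNReal.ofReal_mul (Real.exp_pos _).le]
          refine le_of_eq ?_
          ring
        · rw [Set.indicator_of_notMem hx, mul_zero]
          exact zero_le

end Assumptions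

end LowerBound

/-! ### Exponential Chebyshev inequality and test functions. -/

section Chernoff

variable {M : Type*} [MeasurableSpace M] {n : ℕ} {ω : Measure M}
  {g : M → M → EReal} {V : M → EReal} {θ : M → ℝ} {γ : ℝ}

theorem tendsto_ofReal_exp_mul_succ {r : ℕ → ℝ} {r₀ : ℝ} (hr : Tendsto r atTop (𝓝 r₀))
    (h0 : r₀ < 0) :
    Tendsto (fun N : ℕ => ENNReal.ofReal (Real.exp (((N + 1 : ℕ) : ℝ) * r N))) atTop (𝓝 0) := by
  have h1 : Tendsto (fun N : ℕ => ((N + 1 : ℕ) : ℝ)) atTop atTop :=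
    tendsto_natCast_atTop_atTop.comp (tendsto_add_atTop_nat 1)
  have h2 := Real.tendsto_exp_atBot.comp (h1.atTop_mul_neg h0 hr)
  simpa using ENNReal.tendsto_ofReal h2

/-- Exponential Chebyshev inequality for the Gibbs measure. -/
theorem gibbsMeasure_le [SigmaFinite ω] {N : ℕ} {β a l T : ℝ} {F : M → ℝ≥0∞}
    (hF : Measurable F) (hl : ENNReal.ofReal (Real.exp l) ≤ partitionFunction N ω β g V)
    (hT : ∫⁻ x, F x ∂ω ≤ ENNReal.ofReal (Real.exp T)) {A : Set (Fin N → M)}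
    (hA : ∀ x ∈ A, EReal.exp (-energy β g V x) ≤ ENNReal.ofReal (Real.exp a) * ∏ i, F (x i)) :
    gibbsMeasure N ω β g V A ≤ ENNReal.ofReal (Real.exp (a + N * T - l)) := by
  -- This form of the density formula needs no measurability of `A`, so arbitrary sets of empirical
  -- measures are allowed later.
  rw [gibbsMeasure, Measure.smul_apply, withDensity_apply', smul_eq_mul]
  have hFm : Measurable fun x : Fin N → M => ∏ i, F (x i) :=
    Finset.measurable_fun_prod _ fun i _ => hF.comp (measurable_pi_apply i)
  have h1 : ∫⁻ x in A, EReal.exp (-energy β g V x) ∂(Measure.pi fun _ => ω) ≤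
      ENNReal.ofReal (Real.exp (a + N * T)) := by
    calc ∫⁻ x in A, EReal.exp (-energy β g V x) ∂(Measure.pi fun _ => ω)
        ≤ ∫⁻ x in A, ENNReal.ofReal (Real.exp a) * ∏ i, F (x i) ∂(Measure.pi fun _ => ω) :=
          setLIntegral_mono (hFm.const_mul _) hA
      _ ≤ ∫⁻ x, ENNReal.ofReal (Real.exp a) * ∏ i, F (x i) ∂(Measure.pi fun _ => ω) :=
          setLIntegral_le_lintegral _ _
      _ = ENNReal.ofReal (Real.exp a) * (∫⁻ x, F x ∂ω) ^ N := by
          rw [lintegral_const_mul _ hFm, lintegral_fin_prod_eq_prod fun _ => hF]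
          simp
      _ ≤ ENNReal.ofReal (Real.exp a) * ENNReal.ofReal (Real.exp T) ^ N := by gcongr
      _ = _ := by
          rw [← ENNReal.ofReal_pow (Real.exp_pos _).le, ← Real.exp_nat_mul,
            ← ENNReal.ofReal_mul (Real.exp_pos _).le, ← Real.exp_add]
  have h2 : (partitionFunction N ω β g V)⁻¹ ≤ ENNReal.ofReal (Real.exp (-l)) := by
    rw [Real.exp_neg, ENNReal.ofReal_inv_of_pos (Real.exp_pos _)]
    exact ENNReal.inv_le_inv.2 hl
  refine (mul_le_mul' h2 h1).trans_eq ?_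
  rw [← ENNReal.ofReal_mul (Real.exp_pos _).le, ← Real.exp_add]
  congr 2
  ring

variable [MetricSpace M]

namespace Assumptions

/-- The choice `K = 0` discards the interaction and keeps only the one-particle weights. This
suffices for finiteness of `Z_N` and for tightness. -/
theorem exp_neg_energy_le_prod (hass : Assumptions n ω g V θ) {N : ℕ} {β : ℝ} (hβ : 0 ≤ β)
    (x : Fin N → M) :
    EReal.exp (-energy β g V x) ≤
      ∏ i, (EReal.exp (-V (x i)) * ENNReal.ofReal (Real.exp (β * (N - 1) * θ (x i)))) := by
  have h := hass.exp_neg_energy_le_of_le hβ (K := fun _ => 0) (b := 0) (fun _ => le_rfl)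
    (fun _ => le_rfl) (fun _ => by simp) x
  refine h.trans_eq ?_
  rw [Finset.prod_mul_distrib, ← ENNReal.ofReal_prod_of_nonneg fun i _ => (Real.exp_pos _).le,
    ← Real.exp_sum, ← Finset.mul_sum]
  simp [mul_comm]

variable [BorelSpace M]

theorem partitionFunction_ne_top (hass : Assumptions n ω g V θ) [SigmaFinite ω] (N : ℕ) {β : ℝ}
    (hβ : 0 ≤ β) : partitionFunction (N + 1) ω β g V ≠ ∞ := by
  refine ((lintegral_mono fun x => hass.exp_neg_energy_le_prod hβ x).trans_lt ?_).ne
  rw [lintegral_fin_prod_eq_prod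
    (f := fun _ y => EReal.exp (-V y) * ENNReal.ofReal (Real.exp (β * (((N + 1 : ℕ) : ℝ) - 1) * θ y)))
    fun _ => hass.measurable_weight _]
  refine ENNReal.prod_lt_top fun _ _ => hass.lintegral_weight_lt_top ?_
  push_cast
  have : (0 : ℝ) ≤ N := N.cast_nonneg
  rw [add_sub_cancel_right]
  positivity

theorem isProbabilityMeasure_gibbsMeasure (hass : Assumptions n ω g V θ) [SigmaFinite ω] (N : ℕ)
    {β : ℝ} (hβ : 0 ≤ β) (h0 : partitionFunction (N + 1) ω β g V ≠ 0) :
    IsProbabilityMeasure (gibbsMeasure (N + 1) ω β g V) := by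
  constructor
  rw [gibbsMeasure, Measure.smul_apply, withDensity_apply _ MeasurableSet.univ,
    Measure.restrict_univ, smul_eq_mul]
  exact ENNReal.inv_mul_cancel h0 (hass.partitionFunction_ne_top N hβ)

variable [SecondCountableTopology M]

/-- A measure whose free energy exceeds `m` is detected by bounded continuous functions. -/
theorem exists_test (hass : Assumptions n ω g V θ) (hγ : 0 ≤ γ)
    [IsProbabilityMeasure (referenceMeasure ω V θ γ)] {ρ : ProbabilityMeasure M} {m : ℝ}
    (hρ : ENNReal.ofReal m < freeEnergy ω g V θ γ ρ) :
    ∃ (K : BoundedContinuousFunction (M × M) ℝ) (h : BoundedContinuousFunction M ℝ),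
      (∀ q, 0 ≤ K q) ∧ (∀ q, ENNReal.ofReal (K q) ≤ weightedKernel g θ q.1 q.2) ∧
      m < γ / 2 * ∫ q, K q ∂(ρ.prod ρ : Measure (M × M)) + (∫ x, h x ∂(ρ : Measure M) -
        ∫ x, (Real.exp (h x) - 1) ∂(referenceMeasure ω V θ γ)) := by
  by_contra! hcon
  refine hρ.not_ge ?_
  set ν := referenceMeasure ω V θ γ with hν
  obtain ⟨K, hK0, hKG, hKlim⟩ :=
    exists_boundedContinuous_le_liminf hass.lowerSemicontinuous_weightedKernel
  have hkl : ∀ j, ENNReal.ofReal (γ / 2 * ∫ q, K j q ∂(ρ.prod ρ : Measure (M × M))) +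
      klDiv (ρ : Measure M) ν ≤ ENNReal.ofReal m := by
    intro j
    have hk0 : 0 ≤ γ / 2 * ∫ q, K j q ∂(ρ.prod ρ : Measure (M × M)) :=
      mul_nonneg (by positivity) (integral_nonneg (hK0 j))
    have h1 : klDiv (ρ : Measure M) ν ≤
        ENNReal.ofReal (m - γ / 2 * ∫ q, K j q ∂(ρ.prod ρ : Measure (M × M))) :=
      klDiv_le_of_forall_boundedContinuous fun f => by
        have := hcon (K j) f (hK0 j) (hKG j)
        linarith
    -- The test `h = 0` shows that `m` minus the energy term is non-negative, so `ENNReal.ofReal`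
    -- does not truncate the bound on the entropy.
    have h2 := hcon (K j) 0 (hK0 j) (hKG j)
    simp only [BoundedContinuousFunction.coe_zero, Pi.zero_apply, Real.exp_zero, sub_self,
      integral_zero, add_zero] at h2
    refine (add_le_add_right h1 _).trans_eq ?_
    rw [← ENNReal.ofReal_add hk0 (sub_nonneg.2 h2)]
    congr 1
    ring
  have hklfin : klDiv (ρ : Measure M) ν ≠ ∞ :=
    ne_top_of_le_ne_top ENNReal.ofReal_ne_top (le_add_self.trans (hkl 0))
  have hE : weightedEnergy g θ (ρ : Measure M) ≤
      liminf (fun j => ENNReal.ofReal (∫ q, K j q ∂(ρ.prod ρ : Measure (M × M)))) atTop := by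
    have h1 : weightedEnergy g θ (ρ : Measure M) =
        ∫⁻ q, weightedKernel g θ q.1 q.2 ∂(ρ.prod ρ : Measure (M × M)) :=
      (lintegral_prod _ hass.measurable_weightedKernel.aemeasurable).symm
    rw [h1]
    calc _ ≤ ∫⁻ q, liminf (fun j => ENNReal.ofReal (K j q)) atTop
          ∂(ρ.prod ρ : Measure (M × M)) := lintegral_mono hKlim
      _ ≤ liminf (fun j => ∫⁻ q, ENNReal.ofReal (K j q) ∂(ρ.prod ρ : Measure (M × M))) atTop :=
          lintegral_liminf_le' fun j => (K j).continuous.measurable.ennreal_ofReal.aemeasurable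
      _ = _ := by
          congr 1
          ext j
          rw [ofReal_integral_eq_lintegral_ofReal ((K j).integrable _) (ae_of_all _ (hK0 j))]
  rw [freeEnergy, ← hν]
  -- For `γ > 0` the energy bound is obtained by dividing by `γ / 2`, which is impossible for `γ =
  -- 0`.
  rcases hγ.eq_or_lt with h0 | h0
  · have := hkl 0
    simp only [← h0, zero_div, ENNReal.ofReal_zero, zero_mul, zero_add] at this ⊢
    exact this
  · have hc0 : ENNReal.ofReal (γ / 2) ≠ 0 := by simpa using h0
    have h1 : weightedEnergy g θ (ρ : Measure M) ≤
        (ENNReal.ofReal m - klDiv (ρ : Measure M) ν) / ENNReal.ofReal (γ / 2) := by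
      refine hE.trans (liminf_le_of_frequently_le' (Frequently.of_forall fun j => ?_))
      rw [ENNReal.le_div_iff_mul_le (Or.inl hc0) (Or.inl ENNReal.ofReal_ne_top), mul_comm,
        ← ENNReal.ofReal_mul (by positivity)]
      exact ENNReal.le_sub_of_add_le_right hklfin (hkl j)
    rw [ENNReal.le_div_iff_mul_le (Or.inl hc0) (Or.inl ENNReal.ofReal_ne_top), mul_comm] at h1
    calc _ ≤ (ENNReal.ofReal m - klDiv (ρ : Measure M) ν) + klDiv (ρ : Measure M) ν :=
          add_le_add_left h1 _
      _ = _ := tsub_add_cancel_of_le (le_add_self.trans (hkl 0))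

end Assumptions

theorem integral_empiricalMeasure {X : Type*} [MeasurableSpace X] [MeasurableSingletonClass X]
    {N : ℕ} [NeZero N] (x : Fin N → X) (f : X → ℝ) :
    ∫ y, f y ∂(empiricalMeasure x : Measure X) = (N : ℝ)⁻¹ * ∑ i, f (x i) := by
  change ∫ y, f y ∂((N : ℝ≥0∞)⁻¹ • ∑ j, Measure.dirac (x j)) = _
  rw [integral_smul_measure, integral_finsetSum_measure fun i _ => integrable_dirac (by simp)]
  simp

end Chernoff

/-! ### Exponential decay near non-minimizers. -/

section Concentration

variable {M : Type*} [MeasurableSpace M] {n : ℕ} {ω : Measure M} {g : M → M → EReal}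
  {V : M → EReal} {θ : M → ℝ} {γ : ℝ}

theorem tendsto_succ_mul {β : ℕ → ℝ} (hβ : Tendsto (fun N : ℕ => β N * N) atTop (𝓝 γ)) :
    Tendsto (fun N : ℕ => β (N + 1) * ((N + 1 : ℕ) : ℝ)) atTop (𝓝 γ) ∧
      Tendsto (fun N : ℕ => β (N + 1)) atTop (𝓝 0) ∧
      Tendsto (fun N : ℕ => β (N + 1) * N) atTop (𝓝 γ) := by
  have h1 : Tendsto (fun N : ℕ => β (N + 1) * ((N + 1 : ℕ) : ℝ)) atTop (𝓝 γ) :=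
    hβ.comp (tendsto_add_atTop_nat 1)
  have h2 : Tendsto (fun N : ℕ => (((N + 1 : ℕ) : ℝ))⁻¹) atTop (𝓝 0) :=
    tendsto_inv_atTop_zero.comp (tendsto_natCast_atTop_atTop.comp (tendsto_add_atTop_nat 1))
  have h3 : Tendsto (fun N : ℕ => β (N + 1)) atTop (𝓝 0) := by
    have h4 := h1.mul h2
    rw [mul_zero] at h4
    refine h4.congr fun N => ?_
    have : ((N + 1 : ℕ) : ℝ) ≠ 0 := Nat.cast_ne_zero.2 (Nat.succ_ne_zero N)
    field_simp
  refine ⟨h1, h3, ?_⟩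
  have h4 := h1.sub h3
  rw [sub_zero] at h4
  refine h4.congr fun N => ?_
  push_cast
  ring

/-- Exponential decay of Gibbs probabilities from bounds on the Boltzmann factors. -/
theorem tendsto_gibbsMeasure_zero [SigmaFinite ω] {β : ℕ → ℝ}
    (hβ : Tendsto (fun N : ℕ => β N * N) atTop (𝓝 γ)) {l I : ℝ}
    (hl : ∀ N : ℕ, ENNReal.ofReal (Real.exp (N * l + γ * N * I - β N * (N * (N - 1) / 2 * I))) ≤
      partitionFunction N ω (β N) g V)
    {F : M → ℝ≥0∞} (hF : Measurable F) {T : ℝ} (hT : ∫⁻ x, F x ∂ω ≤ ENNReal.ofReal (Real.exp T))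
    {a : ℕ → ℝ} {a₀ : ℝ} (ha : Tendsto a atTop (𝓝 a₀)) (hneg : a₀ + T - l - γ / 2 * I < 0)
    {A : ∀ N : ℕ, Set (Fin (N + 1) → M)}
    (hA : ∀ᶠ N in atTop, ∀ x ∈ A N, EReal.exp (-energy (β (N + 1)) g V x) ≤
      ENNReal.ofReal (Real.exp (((N + 1 : ℕ) : ℝ) * a N)) * ∏ i, F (x i)) :
    Tendsto (fun N : ℕ => gibbsMeasure (N + 1) ω (β (N + 1)) g V (A N)) atTop (𝓝 0) := by
  obtain ⟨-, -, hβ1⟩ := tendsto_succ_mul hβ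
  -- The exponent per particle. With `N + 1` particles the pair term of the lower bound is `β (N +
  -- 1) * N / 2`, which tends to `γ / 2` and leaves `-γ/2 * I` in the limit.
  have hr : Tendsto (fun N : ℕ => a N + T - l - γ * I + β (N + 1) * N / 2 * I) atTop
      (𝓝 (a₀ + T - l - γ * I + γ / 2 * I)) :=
    (((ha.add_const T).sub_const l).sub_const _).add ((hβ1.div_const 2).mul_const I)
  refine tendsto_of_tendsto_of_tendsto_of_le_of_le' tendsto_const_nhds
    (tendsto_ofReal_exp_mul_succ hr (by linarith)) (Eventually.of_forall fun _ => zero_le) ?_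
  filter_upwards [hA] with N hN
  refine (gibbsMeasure_le hF (hl (N + 1)) hT hN).trans_eq ?_
  congr 2
  push_cast
  ring

variable [MetricSpace M] [BorelSpace M]

namespace Assumptions

/-- Dominated convergence as `δ → 0`, with majorant `exp (‖h‖ + θ) + 1`. The reserve `δ θ` will
absorb the amount by which `β_N (N - 1)` may exceed `γ`, since `θ` can be unbounded. -/
theorem exists_integral_exp_le (hass : Assumptions n ω g V θ) (hγ : 0 ≤ γ)
    (hC : ∫⁻ x, EReal.exp (-shiftedPotential V θ γ x) ∂ω ≠ 0)
    (h : BoundedContinuousFunction M ℝ) {ε : ℝ} (hε : 0 < ε) :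
    ∃ δ : ℝ, 0 < δ ∧ Integrable (fun x => Real.exp (h x + δ * θ x)) (referenceMeasure ω V θ γ) ∧
      ∫ x, (Real.exp (h x + δ * θ x) - 1) ∂(referenceMeasure ω V θ γ) ≤
        ∫ x, (Real.exp (h x) - 1) ∂(referenceMeasure ω V θ γ) + ε := by
  have hνp := hass.isProbabilityMeasure_referenceMeasure hγ hC
  set ν := referenceMeasure ω V θ γ with hν
  set δ : ℕ → ℝ := fun j => 1 / ((j : ℝ) + 1) with hδ
  have hδ0 : ∀ j, 0 < δ j := fun j => by positivity
  have hδ1 : ∀ j, δ j ≤ 1 := fun j => by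
    rw [hδ, div_le_one (by positivity)]
    have : (0 : ℝ) ≤ j := j.cast_nonneg
    linarith
  have hm : ∀ j, Measurable fun x => Real.exp (h x + δ j * θ x) := fun j =>
    (h.continuous.measurable.add (hass.measurable_theta.const_mul _)).exp
  have hexp : Integrable (fun x => Real.exp (θ x)) ν := by
    refine (lintegral_ofReal_ne_top_iff_integrable hass.measurable_theta.exp.aestronglyMeasurable
      (ae_of_all _ fun x => (Real.exp_pos _).le)).1 ?_
    simpa using (hass.lintegral_exp_theta_referenceMeasure_lt_top hγ hC zero_le_one).ne
  have hb : ∀ j x, Real.exp (h x + δ j * θ x) ≤ Real.exp ‖h‖ * Real.exp (θ x) := by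
    intro j x
    rw [← Real.exp_add]
    refine Real.exp_le_exp.2 (add_le_add ((le_abs_self _).trans (h.norm_coe_le_norm x)) ?_)
    exact mul_le_of_le_one_left (hass.theta_nonneg x) (hδ1 j)
  have hi : ∀ j, Integrable (fun x => Real.exp (h x + δ j * θ x)) ν := fun j =>
    (hexp.const_mul (Real.exp ‖h‖)).mono' (hm j).aestronglyMeasurable (ae_of_all _ fun x => by
      rw [Real.norm_eq_abs, abs_of_pos (Real.exp_pos _)]
      exact hb j x)
  have hlim : Tendsto (fun j => ∫ x, (Real.exp (h x + δ j * θ x) - 1) ∂ν) atTop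
      (𝓝 (∫ x, (Real.exp (h x) - 1) ∂ν)) := by
    refine tendsto_integral_of_dominated_convergence
      (fun x => Real.exp ‖h‖ * Real.exp (θ x) + 1)
      (fun j => ((hm j).sub_const 1).aestronglyMeasurable)
      ((hexp.const_mul _).add (integrable_const _)) (fun j => ae_of_all _ fun x => ?_)
      (ae_of_all _ fun x => ?_)
    · refine (norm_sub_le _ _).trans ?_
      rw [Real.norm_eq_abs, abs_of_pos (Real.exp_pos _), norm_one]
      exact add_le_add_left (hb j x) 1
    · have h1 : Tendsto δ atTop (𝓝 0) := tendsto_one_div_add_atTop_nhds_zero_nat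
      have h2 := ((h1.mul_const (θ x)).const_add (h x))
      rw [zero_mul, add_zero] at h2
      exact ((Real.continuous_exp.tendsto _).comp h2).sub_const 1
  obtain ⟨j, hj⟩ := (hlim.eventually_lt_const (lt_add_of_pos_right _ hε)).exists
  exact ⟨δ j, hδ0 j, hi j, hj.le⟩

variable [SecondCountableTopology M]

/-- Every probability measure of non-minimal free energy has a neighbourhood which the empirical
measure avoids with high probability. -/
theorem exists_nhds_tendsto_gibbsMeasure (hass : Assumptions n ω g V θ) [SigmaFinite ω]
    (hγ : 0 ≤ γ) (hC : ∫⁻ x, EReal.exp (-shiftedPotential V θ γ x) ∂ω ≠ 0)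
    {β : ℕ → ℝ} (hβ0 : ∀ N, 0 < β N) (hβ : Tendsto (fun N : ℕ => β N * N) atTop (𝓝 γ)) {l I : ℝ}
    (hl : ∀ N : ℕ, ENNReal.ofReal (Real.exp (N * l + γ * N * I - β N * (N * (N - 1) / 2 * I))) ≤
      partitionFunction N ω (β N) g V)
    {ρ : ProbabilityMeasure M}
    (hρ : ENNReal.ofReal (Real.log (∫⁻ x, EReal.exp (-shiftedPotential V θ γ x) ∂ω).toReal - l -
      γ / 2 * I) < freeEnergy ω g V θ γ ρ) :
    ∃ W ∈ 𝓝 ρ, Tendsto (fun N : ℕ => gibbsMeasure (N + 1) ω (β (N + 1)) g V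
      {x | empiricalMeasure x ∈ W}) atTop (𝓝 0) := by
  have hνp := hass.isProbabilityMeasure_referenceMeasure hγ hC
  obtain ⟨K, h, hK0, hKG, hgap⟩ := hass.exists_test hγ hρ
  set C := ∫⁻ x, EReal.exp (-shiftedPotential V θ γ x) ∂ω with hCdef
  have hCtop : C ≠ ∞ := (hass.confining γ hγ).integrable.ne
  have hC0 : 0 < C.toReal := ENNReal.toReal_pos hC hCtop
  set k := ∫ q, K q ∂(ρ.prod ρ : Measure (M × M)) with hk
  set w := ∫ x, h x ∂(ρ : Measure M) with hw
  set E₀ := ∫ x, (Real.exp (h x) - 1) ∂(referenceMeasure ω V θ γ) with hE₀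
  set η := γ / 2 * k + (w - E₀) - (Real.log C.toReal - l - γ / 2 * I) with hη
  have hη0 : 0 < η := sub_pos.2 hgap
  -- The energy, the linear term and the reserve `δ θ` lose `γ/2 * ε`, `ε` and `ε`: in total `η /
  -- 2`, half of the gap.
  set ε := η / (γ + 4) with hε
  have hε0 : 0 < ε := by positivity
  have hεη : ε * (γ + 4) = η := div_mul_cancel₀ _ (by positivity)
  obtain ⟨δ, hδ, hint, hEδ⟩ := hass.exists_integral_exp_le hγ hC h hε0
  set T := Real.log C.toReal +
    ∫ x, (Real.exp (h x + δ * θ x) - 1) ∂(referenceMeasure ω V θ γ) with hT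
  set F : M → ℝ≥0∞ := fun x =>
    EReal.exp (-V x) * ENNReal.ofReal (Real.exp (h x + (γ + δ) * θ x)) with hF
  have hFm : Measurable F := hass.measurable_exp_neg_potential.mul
    (h.continuous.measurable.add (hass.measurable_theta.const_mul _)).exp.ennreal_ofReal
  -- `F` is `C` times the density of `ν` times `exp (h + δ θ)`; the bound `s ≤ exp (s - 1)` brings
  -- in the form `exp - 1` of the dual functional.
  have hFT : ∫⁻ x, F x ∂ω ≤ ENNReal.ofReal (Real.exp T) := by
    have h1 := hass.lintegral_referenceMeasure (γ := γ) (f := fun x =>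
      ENNReal.ofReal (Real.exp (h x + δ * θ x))) ((h.continuous.measurable.add
        (hass.measurable_theta.const_mul _)).exp.ennreal_ofReal)
    rw [← hCdef] at h1
    have h2 : ∫⁻ x, F x ∂ω = C * ∫⁻ x, ENNReal.ofReal (Real.exp (h x + δ * θ x))
        ∂(referenceMeasure ω V θ γ) := by
      rw [h1, ← mul_assoc, ENNReal.mul_inv_cancel hC hCtop, one_mul]
      refine lintegral_congr fun x => ?_
      simp only [hF]
      rw [mul_assoc, ← ENNReal.ofReal_mul (Real.exp_pos _).le, ← Real.exp_add]
      congr 3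
      ring
    rw [h2, ← ofReal_integral_eq_lintegral_ofReal hint (ae_of_all _ fun x => (Real.exp_pos _).le),
      hT, Real.exp_add, Real.exp_log hC0, ENNReal.ofReal_mul hC0.le, ENNReal.ofReal_toReal hCtop]
    gcongr
    rw [integral_sub hint (integrable_const _)]
    simp only [integral_const, probReal_univ, smul_eq_mul, mul_one]
    have := Real.add_one_le_exp (∫ x, Real.exp (h x + δ * θ x) ∂(referenceMeasure ω V θ γ) - 1)
    linarith
  set W : Set (ProbabilityMeasure M) := {σ | k - ε < ∫ q, K q ∂(σ.prod σ : Measure (M × M)) ∧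
    w - ε < ∫ x, h x ∂(σ : Measure M)} with hW
  have hWo : IsOpen W := by
    have h1 : Continuous fun σ : ProbabilityMeasure M => σ.prod σ :=
      (ProbabilityMeasure.continuous_prod (α := M) (β := M)).comp
        (continuous_id.prodMk continuous_id)
    have h2 : Continuous fun σ : ProbabilityMeasure (M × M) => ∫ q, K q ∂(σ : Measure (M × M)) :=
      ProbabilityMeasure.continuous_integral_boundedContinuousFunction K
    have h3 : Continuous fun σ : ProbabilityMeasure M => ∫ x, h x ∂(σ : Measure M) :=
      ProbabilityMeasure.continuous_integral_boundedContinuousFunction h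
    have h4 : IsOpen {σ : ProbabilityMeasure M | k - ε < ∫ q, K q ∂(σ.prod σ : Measure (M × M))} :=
      isOpen_lt continuous_const (h2.comp h1)
    have h5 : IsOpen {σ : ProbabilityMeasure M | w - ε < ∫ x, h x ∂(σ : Measure M)} :=
      isOpen_lt continuous_const h3
    exact h4.inter h5
  refine ⟨W, hWo.mem_nhds ⟨by linarith, by linarith⟩, ?_⟩
  obtain ⟨hβ1, hβ2, hβ3⟩ := tendsto_succ_mul hβ
  have ha : Tendsto (fun N : ℕ => -(β (N + 1) * ((N + 1 : ℕ) : ℝ) / 2 * (k - ε)) +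
      β (N + 1) / 2 * ‖K‖ - (w - ε)) atTop (𝓝 (-(γ / 2 * (k - ε)) + 0 / 2 * ‖K‖ - (w - ε))) :=
    ((((hβ1.div_const 2).mul_const _).neg).add ((hβ2.div_const 2).mul_const _)).sub_const _
  refine tendsto_gibbsMeasure_zero hβ hl hFm hFT ha ?_ ?_
  · nlinarith
  · filter_upwards [hβ3.eventually_lt_const (show γ < γ + δ by linarith)] with N hN x hx
    obtain ⟨hx1, hx2⟩ := hx
    have hNpos : (0 : ℝ) < ((N + 1 : ℕ) : ℝ) := by positivity
    rw [integral_empiricalMeasure, ← div_eq_inv_mul, lt_div_iff₀ hNpos] at hx2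
    rw [ProbabilityMeasure.toMeasure_prod, integral_prod _ (K.integrable _),
      integral_empiricalMeasure] at hx1
    simp_rw [fun u => integral_empiricalMeasure x fun z => K (u, z)] at hx1
    rw [← Finset.mul_sum, ← div_eq_inv_mul, ← div_eq_inv_mul, lt_div_iff₀ hNpos,
      lt_div_iff₀ hNpos] at hx1
    have hβp := hβ0 (N + 1)
    refine (hass.exp_neg_energy_le_of_le hβp.le hK0
      (fun q => (le_abs_self _).trans (K.norm_coe_le_norm q)) hKG x).trans ?_
    simp only [hF]
    rw [Finset.prod_mul_distrib, ← ENNReal.ofReal_prod_of_nonneg fun i _ => (Real.exp_pos _).le,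
      ← Real.exp_sum, mul_left_comm, ← ENNReal.ofReal_mul (Real.exp_pos _).le, ← Real.exp_add,
      mul_comm]
    refine mul_le_mul_right (ENNReal.ofReal_le_ofReal (Real.exp_le_exp.2 ?_)) _
    rw [Finset.sum_add_distrib, ← Finset.mul_sum]
    have hθs : 0 ≤ ∑ i, θ (x i) := Finset.sum_nonneg fun i _ => hass.theta_nonneg _
    have h1 : β (N + 1) * (((N + 1 : ℕ) : ℝ) - 1) * ∑ i, θ (x i) ≤
        (γ + δ) * ∑ i, θ (x i) := by
      refine mul_le_mul_of_nonneg_right ?_ hθs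
      push_cast
      rw [add_sub_cancel_right]
      exact hN.le
    have h2 := mul_lt_mul_of_pos_left hx1 (half_pos hβp)
    have h3 : ((N + 1 : ℕ) : ℝ) * (-(β (N + 1) * ((N + 1 : ℕ) : ℝ) / 2 * (k - ε)) +
        β (N + 1) / 2 * ‖K‖ - (w - ε)) =
        -(β (N + 1) / 2 * ((k - ε) * ((N + 1 : ℕ) : ℝ) * ((N + 1 : ℕ) : ℝ))) +
          β (N + 1) / 2 * ((N + 1 : ℕ) : ℝ) * ‖K‖ - (w - ε) * ((N + 1 : ℕ) : ℝ) := by ring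
    rw [h3]
    linarith

end Assumptions

end Concentration

/-! ### Exponential tightness and the law of large numbers. -/

section LawOfLargeNumbers

variable {M : Type*} [MeasurableSpace M] {n : ℕ} {ω : Measure M} {g : M → M → EReal}
  {V : M → EReal} {θ : M → ℝ} {γ : ℝ} [MetricSpace M] [BorelSpace M] [SecondCountableTopology M]

/-- A finite measure on a locally compact separable metric space integrates a function growing
exponentially along compact sets. -/
theorem exists_exhaustion_lintegral_lt_top [LocallyCompactSpace M] (τ : Measure M)
    [IsFiniteMeasure τ] :
    ∃ (K : ℕ → Set M) (f : M → ℝ≥0∞), (∀ j, IsCompact (K j)) ∧ Measurable f ∧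
      ∫⁻ x, f x ∂τ < ∞ ∧ (∀ x, 1 ≤ f x) ∧ ∀ j, ∀ x ∉ K j, 2 ^ (j + 1) ≤ f x := by
  obtain ⟨ε, hε0, hε1⟩ := ENNReal.exists_pos_sum_of_countable' (ε := 1) one_ne_zero ℕ
  -- With these masses, `1 + ∑ 2 ^ (j + 1)` on the complements of the `K j` has integral at most
  -- `τ(M) + ∑ ε j`.
  have hK : ∀ j, ∃ K : Set M, IsCompact K ∧ τ Kᶜ ≤ ε j / 2 ^ (j + 1) := by
    intro j
    obtain ⟨K, hK, hKτ⟩ := isTightMeasureSet_iff_exists_isCompact_measure_compl_le.1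
      (isTightMeasureSet_singleton_of_innerRegular (μ := τ)) (ε j / 2 ^ (j + 1))
      (ENNReal.div_pos (hε0 j).ne' (by finiteness))
    exact ⟨K, hK, hKτ τ rfl⟩
  choose K hKc hKτ using hK
  have hm : ∀ j, MeasurableSet (K j)ᶜ := fun j => (hKc j).isClosed.measurableSet.compl
  refine ⟨K, fun x => 1 + ∑' j, (K j)ᶜ.indicator (fun _ => (2 : ℝ≥0∞) ^ (j + 1)) x, hKc, ?_, ?_,
    fun x => le_self_add, fun j x hx => ?_⟩
  · exact measurable_const.add (Measurable.tsum fun j =>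
      (measurable_const (a := (2 : ℝ≥0∞) ^ (j + 1))).indicator (hm j))
  · rw [lintegral_add_left measurable_const, lintegral_tsum fun j =>
      (measurable_const.indicator (hm j)).aemeasurable]
    simp only [lintegral_const, one_mul, lintegral_indicator_const (hm _)]
    refine ENNReal.add_lt_top.2 ⟨measure_lt_top _ _, lt_of_le_of_lt (ENNReal.tsum_le_tsum
      fun j => ?_) (hε1.trans ENNReal.one_lt_top)⟩
    refine (mul_le_mul_right (hKτ j) _).trans_eq ?_
    exact ENNReal.mul_div_cancel (by positivity) (by finiteness)
  · refine le_trans ?_ (le_add_self.trans' (ENNReal.le_tsum j))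
    rw [Set.indicator_of_mem (show x ∈ (K j)ᶜ from hx)]

/-- If the normalization vanished, the reference measure would be zero and every free energy
infinite. All probability measures would then be minimizers, contradicting uniqueness as soon as
there are two Dirac masses. Positivity of the volume on open sets is thus bypassed. -/
theorem normalization_ne_zero [Nontrivial M] {μ : ProbabilityMeasure M}
    (huniq : ∀ ν : ProbabilityMeasure M, (∀ ν' : ProbabilityMeasure M,
      freeEnergy ω g V θ γ ν ≤ freeEnergy ω g V θ γ ν') → ν = μ) :
    ∫⁻ x, EReal.exp (-shiftedPotential V θ γ x) ∂ω ≠ 0 := by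
  intro hC
  have h1 : referenceMeasure ω V θ γ = 0 := by
    have h2 : ω.withDensity (fun x => EReal.exp (-shiftedPotential V θ γ x)) = 0 := by
      rw [← Measure.measure_univ_eq_zero, withDensity_apply _ MeasurableSet.univ,
        Measure.restrict_univ, hC]
    rw [referenceMeasure, h2, smul_zero]
  have h3 : ∀ ν : ProbabilityMeasure M, freeEnergy ω g V θ γ ν = ∞ := fun ν => by
    rw [freeEnergy, h1, klDiv_zero_right, add_top]
  have h4 : ∀ ν : ProbabilityMeasure M, ν = μ := fun ν => huniq ν fun ν' => by rw [h3, h3]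
  obtain ⟨x, y, hxy⟩ := exists_pair_ne M
  have h5 : (⟨Measure.dirac x, inferInstance⟩ : ProbabilityMeasure M) =
      ⟨Measure.dirac y, inferInstance⟩ := (h4 _).trans (h4 _).symm
  have h6 : Measure.dirac x = Measure.dirac y := congrArg Subtype.val h5
  have h7 := congrArg (fun m : Measure M => m {x}) h6
  simp [Measure.dirac_apply' _ (measurableSet_singleton x), hxy.symm] at h7

namespace Assumptions

/-- The empirical measures are exponentially tight under the Gibbs measures. -/
theorem exists_isCompact_tendsto_gibbsMeasure (hass : Assumptions n ω g V θ) [SigmaFinite ω]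
    [LocallyCompactSpace M] (hγ : 0 ≤ γ) {β : ℕ → ℝ} (hβ0 : ∀ N, 0 < β N)
    (hβ : Tendsto (fun N : ℕ => β N * N) atTop (𝓝 γ)) {l I : ℝ}
    (hl : ∀ N : ℕ, ENNReal.ofReal (Real.exp (N * l + γ * N * I - β N * (N * (N - 1) / 2 * I))) ≤
      partitionFunction N ω (β N) g V) :
    ∃ 𝒦 : Set (ProbabilityMeasure M), IsCompact 𝒦 ∧
      Tendsto (fun N : ℕ => gibbsMeasure (N + 1) ω (β (N + 1)) g V
        {x | empiricalMeasure x ∉ 𝒦}) atTop (𝓝 0) := by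
  set τ := ω.withDensity fun x =>
    EReal.exp (-V x) * ENNReal.ofReal (Real.exp ((γ + 1) * θ x)) with hτ
  have hτf : IsFiniteMeasure τ := isFiniteMeasure_withDensity
    (hass.lintegral_weight_lt_top (by linarith)).ne
  obtain ⟨K, f, hK, hf, hfτ, hf1, hfK⟩ := exists_exhaustion_lintegral_lt_top τ
  set F : M → ℝ≥0∞ := fun x =>
    EReal.exp (-V x) * ENNReal.ofReal (Real.exp ((γ + 1) * θ x)) * f x with hF
  have hFτ : ∫⁻ x, F x ∂ω = ∫⁻ x, f x ∂τ := by
    rw [hτ, lintegral_withDensity_eq_lintegral_mul _ (hass.measurable_weight _) hf]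
    rfl
  set T := (∫⁻ x, F x ∂ω).toReal with hT
  have hFT : ∫⁻ x, F x ∂ω ≤ ENNReal.ofReal (Real.exp T) := by
    rw [← ENNReal.ofReal_toReal (hFτ ▸ hfτ.ne : ∫⁻ x, F x ∂ω ≠ ∞), ← hT]
    refine ENNReal.ofReal_le_ofReal ?_
    linarith [Real.add_one_le_exp T]
  -- Large enough for the final rate `-R + T - l - γ/2 * I` to be negative.
  set R := |T - l - γ / 2 * I| + 1 with hR
  have hR0 : 0 < R := by positivity
  have hlog : 0 < Real.log 2 := Real.log_pos one_lt_two
  -- If a fraction of the particles exceeding `u j` lies outside `K j`, where `f ≥ 2 ^ (j + 1)`,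
  -- then the product of the `f (x i)` is at least `exp (N R)` for `N` particles. As `u j → 0`, the
  -- bounds `σ (K j)ᶜ ≤ u j` define a compact set.
  set u : ℕ → ℝ≥0 := fun j => (R / Real.log 2 * (1 / ((j : ℝ) + 1))).toNNReal with hu
  have hulim : Tendsto u atTop (𝓝 0) := by
    have h1 := (tendsto_one_div_add_atTop_nhds_zero_nat (𝕜 := ℝ)).const_mul (R / Real.log 2)
    have h2 := (continuous_real_toNNReal.tendsto _).comp h1
    rwa [mul_zero, Real.toNNReal_zero] at h2
  refine ⟨{σ | ∀ j, σ (K j)ᶜ ≤ u j},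
    isCompact_setOfPred_probabilityMeasure_mass_eq_compl_isCompact_le hulim hK
      (Or.inl inferInstance), ?_⟩
  refine tendsto_gibbsMeasure_zero (F := F) hβ hl ((hass.measurable_weight _).mul hf) hFT
    (tendsto_const_nhds (x := -R)) ?_ ?_
  · have := le_abs_self (T - l - γ / 2 * I)
    linarith
  · obtain ⟨-, -, hβ3⟩ := tendsto_succ_mul hβ
    filter_upwards [hβ3.eventually_lt_const (lt_add_one γ)] with N hN x hx
    have hx' : ∃ j, u j < empiricalMeasure x (K j)ᶜ := by
      by_contra! h
      exact hx h
    obtain ⟨j, hj⟩ := hx'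
    have hNpos : (0 : ℝ) < ((N + 1 : ℕ) : ℝ) := by positivity
    have hj1 : (0 : ℝ) < (j : ℝ) + 1 := by positivity
    have hm : MeasurableSet (K j)ᶜ := (hK j).isClosed.measurableSet.compl
    have h1 : R / Real.log 2 * (1 / ((j : ℝ) + 1)) <
        (((N + 1 : ℕ) : ℝ))⁻¹ * ∑ i, (K j)ᶜ.indicator (fun _ => (1 : ℝ)) (x i) := by
      rw [← integral_empiricalMeasure, integral_indicator_const _ hm, smul_eq_mul, mul_one,
        ProbabilityMeasure.measureReal_eq_coe_coeFn]
      have h2 := NNReal.coe_lt_coe.2 hj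
      rwa [Real.coe_toNNReal _ (by positivity)] at h2
    have h2 : ((N + 1 : ℕ) : ℝ) * R ≤
        ∑ i, ((j : ℝ) + 1) * Real.log 2 * (K j)ᶜ.indicator (fun _ => (1 : ℝ)) (x i) := by
      rw [← Finset.mul_sum]
      rw [← div_eq_inv_mul, lt_div_iff₀ hNpos, div_mul_div_comm, mul_one, div_mul_eq_mul_div,
        div_lt_iff₀ (by positivity)] at h1
      linarith
    have h3 : ENNReal.ofReal (Real.exp (((N + 1 : ℕ) : ℝ) * R)) ≤ ∏ i, f (x i) := by
      refine (ENNReal.ofReal_le_ofReal (Real.exp_le_exp.2 h2)).trans ?_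
      rw [Real.exp_sum, ENNReal.ofReal_prod_of_nonneg fun i _ => (Real.exp_pos _).le]
      refine Finset.prod_le_prod' fun i _ => ?_
      by_cases hi : x i ∈ (K j)ᶜ
      · refine le_trans (le_of_eq ?_) (hfK j (x i) hi)
        rw [Set.indicator_of_mem hi, mul_one,
          show ((j : ℝ) + 1) * Real.log 2 = ((j + 1 : ℕ) : ℝ) * Real.log 2 by push_cast; ring,
          Real.exp_nat_mul, Real.exp_log two_pos, ENNReal.ofReal_pow zero_le_two,
          ENNReal.ofReal_ofNat]
      · rw [Set.indicator_of_notMem hi, mul_zero, Real.exp_zero, ENNReal.ofReal_one]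
        exact hf1 _
    have h4 : 1 ≤ ENNReal.ofReal (Real.exp (((N + 1 : ℕ) : ℝ) * -R)) * ∏ i, f (x i) := by
      refine le_trans (le_of_eq ?_) (mul_le_mul_right h3 _)
      rw [← ENNReal.ofReal_mul (Real.exp_pos _).le, ← Real.exp_add, mul_neg, neg_add_cancel,
        Real.exp_zero, ENNReal.ofReal_one]
    calc EReal.exp (-energy (β (N + 1)) g V x)
        ≤ ∏ i, (EReal.exp (-V (x i)) * ENNReal.ofReal
            (Real.exp (β (N + 1) * (((N + 1 : ℕ) : ℝ) - 1) * θ (x i)))) :=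
          hass.exp_neg_energy_le_prod (hβ0 _).le x
      _ ≤ ∏ i, (EReal.exp (-V (x i)) * ENNReal.ofReal (Real.exp ((γ + 1) * θ (x i)))) := by
          refine Finset.prod_le_prod' fun i _ => mul_le_mul_right (ENNReal.ofReal_le_ofReal
            (Real.exp_le_exp.2 (mul_le_mul_of_nonneg_right ?_ (hass.theta_nonneg _)))) _
          push_cast
          rw [add_sub_cancel_right]
          exact hN.le
      _ ≤ (ENNReal.ofReal (Real.exp (((N + 1 : ℕ) : ℝ) * -R)) * ∏ i, f (x i)) *
          ∏ i, (EReal.exp (-V (x i)) * ENNReal.ofReal (Real.exp ((γ + 1) * θ (x i)))) :=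
          le_mul_of_one_le_left zero_le h4
      _ = _ := by
          simp only [hF, Finset.prod_mul_distrib]
          ring

/-- Law of large numbers for the Gibbs measures around the unique minimizer. -/
theorem tendsto_gibbsMeasure_notMem (hass : Assumptions n ω g V θ) [SigmaFinite ω]
    [LocallyCompactSpace M] (hγ : 0 ≤ γ)
    (hC : ∫⁻ x, EReal.exp (-shiftedPotential V θ γ x) ∂ω ≠ 0) {μ : ProbabilityMeasure M}
    (hmin : ∀ ν : ProbabilityMeasure M, freeEnergy ω g V θ γ μ ≤ freeEnergy ω g V θ γ ν)
    (huniq : ∀ ν : ProbabilityMeasure M, (∀ ν' : ProbabilityMeasure M,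
      freeEnergy ω g V θ γ ν ≤ freeEnergy ω g V θ γ ν') → ν = μ)
    {β : ℕ → ℝ} (hβ0 : ∀ N, 0 < β N) (hβ : Tendsto (fun N : ℕ => β N * N) atTop (𝓝 γ)) {l I : ℝ}
    (hl : ∀ N : ℕ, ENNReal.ofReal (Real.exp (N * l + γ * N * I - β N * (N * (N - 1) / 2 * I))) ≤
      partitionFunction N ω (β N) g V)
    (hμ : freeEnergy ω g V θ γ μ = ENNReal.ofReal
      (Real.log (∫⁻ x, EReal.exp (-shiftedPotential V θ γ x) ∂ω).toReal - l - γ / 2 * I))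
    {𝒰 : Set (ProbabilityMeasure M)} (h𝒰 : 𝒰 ∈ 𝓝 μ) :
    Tendsto (fun N : ℕ => gibbsMeasure (N + 1) ω (β (N + 1)) g V
      {x | empiricalMeasure x ∉ 𝒰}) atTop (𝓝 0) := by
  obtain ⟨𝒦, h𝒦, hlim⟩ := hass.exists_isCompact_tendsto_gibbsMeasure hγ hβ0 hβ hl
  have hcomp : IsCompact (𝒦 \ interior 𝒰) := h𝒦.diff isOpen_interior
  have hunion : ∀ S S' : Set (ProbabilityMeasure M),
      Tendsto (fun N : ℕ => gibbsMeasure (N + 1) ω (β (N + 1)) g V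
        {x | empiricalMeasure x ∈ S}) atTop (𝓝 0) →
      Tendsto (fun N : ℕ => gibbsMeasure (N + 1) ω (β (N + 1)) g V
        {x | empiricalMeasure x ∈ S'}) atTop (𝓝 0) →
      Tendsto (fun N : ℕ => gibbsMeasure (N + 1) ω (β (N + 1)) g V
        {x | empiricalMeasure x ∈ S ∪ S'}) atTop (𝓝 0) := by
    intro S S' hS hS'
    have h := hS.add hS'
    rw [add_zero] at h
    exact tendsto_of_tendsto_of_tendsto_of_le_of_le tendsto_const_nhds h (fun _ => zero_le)
      fun N => measure_union_le _ _
  have hmono : ∀ S S' : Set (ProbabilityMeasure M), S ⊆ S' →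
      Tendsto (fun N : ℕ => gibbsMeasure (N + 1) ω (β (N + 1)) g V
        {x | empiricalMeasure x ∈ S'}) atTop (𝓝 0) →
      Tendsto (fun N : ℕ => gibbsMeasure (N + 1) ω (β (N + 1)) g V
        {x | empiricalMeasure x ∈ S}) atTop (𝓝 0) := fun S S' hSS h =>
    tendsto_of_tendsto_of_tendsto_of_le_of_le tendsto_const_nhds h (fun _ => zero_le)
      fun N => measure_mono fun x hx => hSS hx
  have hmain : Tendsto (fun N : ℕ => gibbsMeasure (N + 1) ω (β (N + 1)) g V
      {x | empiricalMeasure x ∈ 𝒦 \ interior 𝒰}) atTop (𝓝 0) := by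
    -- Sets of vanishing probability are stable under subsets and finite unions, so by compactness a
    -- local statement at each `ρ ≠ μ` is enough.
    refine hcomp.induction_on (p := fun S => Tendsto (fun N : ℕ =>
      gibbsMeasure (N + 1) ω (β (N + 1)) g V {x | empiricalMeasure x ∈ S}) atTop (𝓝 0))
      (by simp) (fun S S' h1 h2 => hmono S S' h1 h2) (fun S S' h1 h2 => hunion S S' h1 h2)
      fun ρ hρ => ?_
    have hne : ρ ≠ μ := fun h => hρ.2 (h ▸ mem_interior_iff_mem_nhds.2 h𝒰)
    have hlt : freeEnergy ω g V θ γ μ < freeEnergy ω g V θ γ ρ := by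
      by_contra! h
      exact hne (huniq ρ fun ν' => h.trans (hmin ν'))
    obtain ⟨W, hW, hWlim⟩ := hass.exists_nhds_tendsto_gibbsMeasure hγ hC hβ0 hβ hl (hμ ▸ hlt)
    exact ⟨W, mem_nhdsWithin_of_mem_nhds hW, hWlim⟩
  refine hmono 𝒰ᶜ (𝒦ᶜ ∪ 𝒦 \ interior 𝒰) (fun ρ hρ => ?_) (hunion _ _ hlim hmain)
  by_cases h : ρ ∈ 𝒦
  · exact Or.inr ⟨h, fun h2 => hρ (interior_subset h2)⟩
  · exact Or.inl h

end Assumptions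

end LawOfLargeNumbers

/-! ### Geometry: the volume is σ-finite, the manifold is not a point. -/

section Manifold

/-- Cut each disjointed piece by the chart preimages of spanning sets. Only one summand charges such
a set, and it does so with finite mass because `m i` does not charge the complement of the chart's
target. -/
theorem sigmaFinite_sum_restrict_map_symm {M H : Type*} [TopologicalSpace M] [MeasurableSpace M]
    [BorelSpace M] [TopologicalSpace H] [MeasurableSpace H] [BorelSpace H] [Nonempty H]
    (e : ℕ → OpenPartialHomeomorph M H) (m : ℕ → Measure H) [∀ i, SigmaFinite (m i)]
    (hm : ∀ i, m i (e i).targetᶜ = 0) (hcov : ⋃ i, (e i).source = Set.univ) :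
    SigmaFinite (Measure.sum fun i =>
      ((m i).map (e i).symm).restrict (disjointed (fun j => (e j).source) i)) := by
  set D := disjointed fun j => (e j).source with hD
  have hDm : ∀ i, MeasurableSet (D i) := fun i =>
    MeasurableSet.disjointed (fun j => (e j).open_source.measurableSet) i
  have hDs : ∀ i, D i ⊆ (e i).source := fun i => disjointed_subset _ i
  have hDd : Pairwise (Function.onFun Disjoint D) := disjoint_disjointed _
  -- `Measure.map` is zero by default for a map that is not a.e. measurable, so the inequality holds
  -- without checking measurability of the inverse chart.
  have hmap : ∀ i (s : Set M), MeasurableSet s →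
      ((m i).map (e i).symm) s ≤ m i ((e i).symm ⁻¹' s) := by
    intro i s hs
    by_cases h : AEMeasurable (e i).symm (m i)
    · rw [Measure.map_apply_of_aemeasurable h hs]
    · rw [Measure.map_of_not_aemeasurable h]
      simp
  set T : ℕ → ℕ → Set M := fun i k => D i ∩ (e i) ⁻¹' (spanningSets (m i) k) with hT
  have hTm : ∀ i k, MeasurableSet (T i k) := by
    intro i k
    classical
    obtain ⟨y⟩ := ‹Nonempty H›
    have h1 : Measurable ((e i).source.piecewise (e i) fun _ => y) :=
      (e i).continuousOn.measurable_piecewise continuousOn_const (e i).open_source.measurableSet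
    have h2 : T i k = D i ∩ (e i).source.piecewise (e i) (fun _ => y) ⁻¹'
        spanningSets (m i) k := by
      ext x
      refine and_congr_right fun hx => ?_
      simp only [Set.mem_preimage, Set.piecewise_eq_of_mem _ _ _ (hDs i hx)]
    rw [h2]
    exact (hDm i).inter (h1 (measurableSet_spanningSets _ k))
  refine Measure.sigmaFinite_of_countable (S := Set.range fun p : ℕ × ℕ => T p.1 p.2)
    (Set.countable_range _) ?_ ?_
  · rintro _ ⟨⟨i, k⟩, rfl⟩
    simp only
    rw [Measure.sum_apply _ (hTm i k), tsum_eq_single i]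
    · rw [Measure.restrict_apply (hTm i k)]
      refine lt_of_le_of_lt (measure_mono Set.inter_subset_left) ((hmap i _ (hTm i k)).trans_lt ?_)
      have h1 : (e i).symm ⁻¹' T i k ⊆ spanningSets (m i) k ∪ (e i).targetᶜ := by
        intro y hy
        by_cases hyt : y ∈ (e i).target
        · left
          have := hy.2
          rwa [Set.mem_preimage, (e i).right_inv hyt] at this
        · exact Or.inr hyt
      refine (measure_mono h1).trans_lt ((measure_union_le _ _).trans_lt ?_)
      rw [hm, add_zero]
      exact measure_spanningSets_lt_top _ _
    · intro j hj
      rw [Measure.restrict_apply (hTm i k)]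
      have h1 : T i k ∩ D j = ∅ :=
        ((hDd hj.symm).mono_left Set.inter_subset_left).inter_eq
      rw [h1, measure_empty]
  · refine Set.eq_univ_of_forall fun x => ?_
    have hx : x ∈ ⋃ i, D i := by
      rw [hD, iUnion_disjointed, hcov]
      trivial
    obtain ⟨i, hi⟩ := Set.mem_iUnion.1 hx
    have hy : e i x ∈ ⋃ k, spanningSets (m i) k := by
      rw [iUnion_spanningSets]
      trivial
    obtain ⟨k, hk⟩ := Set.mem_iUnion.1 hy
    exact ⟨_, ⟨(i, k), rfl⟩, hi, hk⟩

variable {n : ℕ} {M : Type*} [MetricSpace M] [ChartedSpace (EuclideanSpace ℝ (Fin n)) M]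

theorem sigmaFinite_riemannianVolume [Nonempty M] [SecondCountableTopology M] [MeasurableSpace M]
    [BorelSpace M] [RiemannianBundle
      (fun x : M => TangentSpace (modelWithCornersSelf ℝ (EuclideanSpace ℝ (Fin n))) x)] :
    SigmaFinite (riemannianVolume n M) := by
  refine sigmaFinite_sum_restrict_map_symm
    (fun i => chartAt (EuclideanSpace ℝ (Fin n)) (chartCenter n M i)) _ (fun i => ?_)
    (exists_countable_chart_cover n M).choose_spec
  refine withDensity_absolutelyContinuous _ _ ?_
  rw [Measure.restrict_apply (OpenPartialHomeomorph.open_target _).measurableSet.compl,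
    Set.compl_inter_self, measure_empty]

variable (n M) in
-- In a one-point space the target of a chart would be an open singleton of a Euclidean space of
-- positive dimension.
theorem nontrivial_of_chartedSpace [NeZero n] [Nonempty M] : Nontrivial M := by
  by_contra h
  rw [not_nontrivial_iff_subsingleton] at h
  obtain ⟨x⟩ := ‹Nonempty M›
  set e := chartAt (EuclideanSpace ℝ (Fin n)) x with he
  have hx : e x ∈ e.target := e.map_source (mem_chart_source _ x)
  have h1 : e.target = {e x} := by
    refine Set.eq_singleton_iff_unique_mem.2 ⟨hx, fun y hy => ?_⟩
    rw [← e.right_inv hy]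
    exact congrArg e (Subsingleton.elim _ _)
  have h2 : IsOpen ({e x} : Set (EuclideanSpace ℝ (Fin n))) := h1 ▸ e.open_target
  have h3 : Nontrivial (EuclideanSpace ℝ (Fin n)) := by
    refine ⟨⟨EuclideanSpace.single 0 1, 0, fun h => ?_⟩⟩
    simpa using congrArg (fun v => v 0) h
  have h4 : (𝓝[≠] (e x)).NeBot := Module.punctured_nhds_neBot ℝ _ _
  exact not_isOpen_singleton (e x) h2

end Manifold

end GibbsGas

end

open GibbsGas in
theorem mainTheorem9 {n : ℕ} [NeZero n]
    {M : Type*} [MetricSpace M] [ConnectedSpace M] [SecondCountableTopology M]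
    [MeasurableSpace M] [BorelSpace M]
    [ChartedSpace (EuclideanSpace ℝ (Fin n)) M]
    [IsManifold (modelWithCornersSelf ℝ (EuclideanSpace ℝ (Fin n))) ((⊤ : ℕ∞) : WithTop ℕ∞) M]
    [RiemannianBundle
      (fun x : M => TangentSpace (modelWithCornersSelf ℝ (EuclideanSpace ℝ (Fin n))) x)]
    [IsContMDiffRiemannianBundle (modelWithCornersSelf ℝ (EuclideanSpace ℝ (Fin n)))
      ((⊤ : ℕ∞) : WithTop ℕ∞) (EuclideanSpace ℝ (Fin n))
      (fun x : M => TangentSpace (modelWithCornersSelf ℝ (EuclideanSpace ℝ (Fin n))) x)]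
    [IsRiemannianManifold (modelWithCornersSelf ℝ (EuclideanSpace ℝ (Fin n))) M]
    (g : M → M → EReal) (V : M → EReal) (θ : M → ℝ)
    (hass : Assumptions n (riemannianVolume n M) g V θ)
    (γ : ℝ) (hγ : 0 ≤ γ) (μ : ProbabilityMeasure M)
    (hmin : ∀ ν : ProbabilityMeasure M,
      freeEnergy (riemannianVolume n M) g V θ γ μ ≤ freeEnergy (riemannianVolume n M) g V θ γ ν)
    (huniq : ∀ ν : ProbabilityMeasure M,
      (∀ ν' : ProbabilityMeasure M, freeEnergy (riemannianVolume n M) g V θ γ ν ≤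
        freeEnergy (riemannianVolume n M) g V θ γ ν') → ν = μ) :
    (∀ β : ℕ → ℝ, (∀ N, 0 < β N) → Tendsto (fun N : ℕ => β N * N) atTop (𝓝 γ) →
      (∀ N : ℕ, IsProbabilityMeasure
        (gibbsMeasure (N + 1) (riemannianVolume n M) (β (N + 1)) g V)) ∧
      ∀ 𝒰 ∈ 𝓝 μ, Tendsto
        (fun N : ℕ => gibbsMeasure (N + 1) (riemannianVolume n M) (β (N + 1)) g V
          {x | empiricalMeasure x ∉ 𝒰}) atTop (𝓝 0)) ∧
    (∀ x, (∀ᵐ z ∂(μ : Measure M), g x z ≠ ⊤) ∧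
      Integrable (fun z => (g x z).toReal) (μ : Measure M)) ∧
    Continuous (potential g (μ : Measure M)) ∧
    ∃ L : ℝ, 0 < L ∧ (μ : Measure M) = (riemannianVolume n M).withDensity fun x =>
      ENNReal.ofReal L⁻¹ *
        EReal.exp (-(((γ * potential g (μ : Measure M) x : ℝ) : EReal) + V x)) := by
  have : LocallyCompactSpace M := ChartedSpace.locallyCompactSpace (EuclideanSpace ℝ (Fin n)) M
  have := nontrivial_of_chartedSpace n M
  have := sigmaFinite_riemannianVolume (n := n) (M := M)
  have hC := normalization_ne_zero huniq
  obtain ⟨D, hD⟩ := hass.minimizer_le_smul hγ hC hmin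
  obtain ⟨-, hθ, -⟩ := hass.minimizer_eq_tilted hγ hC hmin
  obtain ⟨L, hL, hdens, hF⟩ := hass.exists_minimizer_eq_withDensity hγ hC hmin
  refine ⟨fun β hβ0 hβ => ?_, fun x => ⟨hass.ae_kernel_ne_top hD hθ x,
    hass.integrable_kernel hD hθ x⟩, hass.continuous_potential hD hθ, L, hL, hdens⟩
  -- The Jensen bound serves twice: it makes the partition functions positive, and its rate, with `l
  -- = log L` and `I = ∫ U dμ`, matches the minimum computed in `hF`.
  have hl := fun N : ℕ => hass.le_partitionFunction hD hθ hL hdens N (β N)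
  exact ⟨fun N => hass.isProbabilityMeasure_gibbsMeasure _ (hβ0 _).le
    ((ENNReal.ofReal_pos.2 (Real.exp_pos _)).trans_le (hl _)).ne', fun 𝒰 h𝒰 =>
    hass.tendsto_gibbsMeasure_notMem hγ hC hmin huniq hβ0 hβ hl hF h𝒰⟩
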